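/- **Theorem (modified Law of Robustness).** There is an absolute constant $a_1>0$ such that the following holds. Let $d,p,n,k$ be natural numbers, $c>0$, $R\in\mathbb R$, $J\ge 0$ and $\epsilon,\delta\in(0,1)$. *Function class.* Let $\mathcal W\subset\mathbb R^p$ be bounded with $\operatorname{diam}(\mathcal W)\le R$ (Euclidean norm). For every mask $\mathbf m\in\{0,1\}^p$ let $\mathcal W_{\mathbf m}\subset\mathcal W$ be a set of weights with $\mathbf w_i=0$ whenever $\mathbf w\in\mathcal W_{\mathbf m}$ and $\mathbf m_i=0$, and let $\mathcal F=\{f_{\mathbf m,\mathbf w}:\mathbb R^d\to\mathbb R \mid \mathbf m\in\{0,1\}^p,\ \mathbf w\in\mathcal W_{\mathbf m}\}$, where for each $\mathbf m$ and all $\mathbf w_1,\mathbf w_2\in\mathcal W_{\mathbf m}$ $$\|f_{\mathbf m,\mathbf w_1}-f_{\mathbf m,\mathbf w_2}\|_\infty\le J\|\mathbf w_1-\mathbf w_2\|.$$ *Data.* Let $\mathcal D=((x_i,y_i))_{i\le n}$ be i.i.d. pairs in $\mathbb R^d\times[-1,1]$ such that - the law $\mu$ of $x_i$ is $\mu=\sum_{\ell=1}^k\alpha_\ell\mu_\ell$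 with $\alpha_\ell\ge0$, $\sum_\ell\alpha_\ell=1$, where each $\mu_\ell$ is a $c$-isoperimetric probability measure, i.e. for every bounded $L$-Lipschitz $h:\mathbb R^d\to\mathbb R$ and every $t\ge0$, $\mu_\ell\big(|h-\mathbb E^{\mu_\ell}h|\ge t\big)\le 2e^{-dt^2/(2cL^2)}$; - $\sigma^2:=\mathbb E^{x\sim\mu}[\operatorname{Var}(y\mid x)]>0$; - $8^3k\log(8k/\delta)\le n\epsilon^2$. *Algorithm.* Let $(\mathbf m^W,\mathbf w^W)$ be random variables, defined on the same probability space as $\mathcal D$ and depending on $\mathcal D$ in an arbitrary, possibly randomized, way, with $\mathbf w^W\in\mathcal W_{\mathbf m^W}$; the output of the algorithm is $f^W=f_{\mathbf m^W,\mathbf w^W}$. Then there is an event of probability at least $1-\delta$ on which $$\frac1n\sum_{i=1}^n\big(f^W(x_i)-y_i\big)^2\le\sigma^2-\epsilon\ \Longrightarrow\ \operatorname{Lip}(f^W)\ge\frac{\epsilon}{96\,a_1\sqrt{2c}}\sqrt{\frac{nd\,\delta}{p_{\rm eff}+\frac\delta2\log(4/\delta)}},$$ where $\operatorname{Lip}(f)\in[0,\infty]$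 is the least Lipschitz constant of $f$ ($\infty$ if there is none), and $$p_{\rm eff}=I(\mathbf m^W;\mathcal D)+\mathbb E\big[\|\mathbf m^W\|_1\big]\,\log_2\!\big(1+60RJ\epsilon^{-1}\big),$$ with $I(\cdot\,;\cdot)$ the mutual information in bits and $\log$ the natural logarithm. -/

import Mathlib

open MeasureTheory ProbabilityTheory
open scoped ENNReal NNReal

namespace MaskedRobustness

/-- Covariate space and weight space: `ℝ^d` with its Euclidean norm. -/
abbrev Euc (d : ℕ) : Type := EuclideanSpace ℝ (Fin d)

/-- Sparsity masks in `{0, 1}^p`; `true` is `1` (kept), `false` is `0` (pruned). -/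
abbrev Mask (p : ℕ) : Type := Fin p → Bool

/-- `‖m‖₁`, the number of unmasked coordinates. -/
def Mask.size {p : ℕ} (m : Mask p) : ℕ := (Finset.univ.filter fun i => m i = true).card

/-- `c`-isoperimetry of a probability measure on `ℝ^d`: every bounded `L`-Lipschitz function
concentrates around its mean with Gaussian rate `d / (2 c L²)`. (For `L = 0` the function is
constant and there is nothing to require; the inequality then reads `_ ≤ 2`.) -/
def IsIsoperimetric {d : ℕ} (c : ℝ) (μ : Measure (Euc d)) : Prop :=
  IsProbabilityMeasure μ ∧
    ∀ (f : Euc d → ℝ) (L : ℝ≥0), (∃ B : ℝ, ∀ x, |f x| ≤ B) → LipschitzWith L f →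
      ∀ t : ℝ, 0 ≤ t →
        μ.real {x | t ≤ |f x - ∫ x', f x' ∂μ|} ≤
          2 * Real.exp (-((d : ℝ) * t ^ 2 / (2 * c * (L : ℝ) ^ 2)))

/-- `μ` is a convex combination of `k` measures, each of them `c`-isoperimetric. -/
def IsIsoperimetricMixture {d : ℕ} (k : ℕ) (c : ℝ) (μ : Measure (Euc d)) : Prop :=
  ∃ (α : Fin k → ℝ) (μs : Fin k → Measure (Euc d)),
    (∀ l, 0 ≤ α l) ∧ ∑ l, α l = 1 ∧ (∀ l, IsIsoperimetric c (μs l)) ∧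
      μ = ∑ l, ENNReal.ofReal (α l) • μs l

/-- The noise level `σ² = E[Var[y | x]]` of the joint law `ν` of one pair `(x, y)`. -/
noncomputable def noiseLevel {d : ℕ} (ν : Measure (Euc d × ℝ)) : ℝ :=
  ∫ z, condVar (MeasurableSpace.comap (Prod.fst : Euc d × ℝ → Euc d) inferInstance)
    (Prod.snd : Euc d × ℝ → ℝ) ν z ∂ν

/-- The Lipschitz constant of a function: the least `K` such that it is `K`-Lipschitz,
and `∞` if there is none. -/
noncomputable def lipConst {d : ℕ} (f : Euc d → ℝ) : ℝ≥0∞ :=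
  ⨅ (K : ℝ≥0) (_ : LipschitzWith K f), (K : ℝ≥0∞)

/-- Mutual information of two random variables, in bits: the Kullback-Leibler divergence of the
joint law from the product of the marginal laws, divided by `log 2`. -/
noncomputable def mutualInfoBits {Ω α β : Type*} [MeasurableSpace Ω] [MeasurableSpace α]
    [MeasurableSpace β] (P : Measure Ω) (A : Ω → α) (B : Ω → β) : ℝ≥0∞ :=
  InformationTheory.klDiv (P.map fun ω => (A ω, B ω)) ((P.map A).prod (P.map B)) /
    ENNReal.ofReal (Real.log 2)

/-- The effective parameter count of a random mask `M` trained on the random data set `D`: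
`I(M; D) + E‖M‖₁ · log₂ (1 + 60 R J / ε)`, for weight diameter `R` and parametrization constant
`J`. (The mutual information is finite, since `M` takes finitely many values.) -/
noncomputable def effectiveParams {Ω β : Type*} [MeasurableSpace Ω] [MeasurableSpace β] {p : ℕ}
    (P : Measure Ω) (M : Ω → Mask p) (D : Ω → β) (R J ε : ℝ) : ℝ :=
  (mutualInfoBits P M D).toReal +
    (∫ ω, ((M ω).size : ℝ) ∂P) * Real.logb 2 (1 + 60 * R * J / ε)

/-- The mean squared training error of `f` on a data set of `n` pairs. -/
noncomputable def trainingError {d n : ℕ} (f : Euc d → ℝ) (D : Fin n → Euc d × ℝ) : ℝ :=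
  (1 / (n : ℝ)) * ∑ i, (f (D i).1 - (D i).2) ^ 2

end MaskedRobustness

/-! Let z = y - g(x) be the noise, with g(x) = E[y | x]. Expanding the square shows that a function
fitting below the noise level must correlate with z: once the averages of z² and z g(x) are close to
their means, the average of z f(x) exceeds ε/4. For a fixed L-Lipschitz F with values in [-1, 1] and
small L this is unlikely. Split F by the posterior membership weights r_l of the mixture into its
component means and the fluctuation ∑ r_l (F - E_l F). The means are handled for all F at once by
2^k sign patterns, which is what the lower bound on n pays for. The fluctuation has a
square-exponential moment at scale v = c L² / d. Multiplied by z, which is bounded and orthogonal to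
functions of x, it is sub-Gaussian (`hasSubgaussianMGF_mul`), so correlation ε/20 has probability
exponentially small in n ε² / v.

For the trained function, each mask m gets a net of at most (1 + 60RJ/ε)^‖m‖₁ functions and a union
bound. There is no union bound over masks: the dependence of the mask on the data is paid for by
mutual information, through the Donsker-Varadhan inequality (`measureReal_mem_le_mutualInfo`). That
bounds the failure probability only by the reciprocal of the exponent, hence the factor δ under the
square root. -/

namespace MaskedRobustness

/-! ### Covering numbers of masked weight sets. -/

section Covering

variable {E : Type*} [NormedAddCommGroup E] [NormedSpace ℝ E] [FiniteDimensional ℝ E]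

/-- Volume bound for the size of an `η`-separated set of diameter at most `R`. -/
theorem card_le_of_separated (s : Finset E) {R η : ℝ} (hη : 0 < η) (hR : 0 ≤ R)
    (hs : ∀ x ∈ s, ∀ y ∈ s, dist x y ≤ R) (h : ∀ x ∈ s, ∀ y ∈ s, x ≠ y → η ≤ dist x y) :
    (s.card : ℝ) ≤ (1 + 2 * R / η) ^ Module.finrank ℝ E := by
  classical
  rcases s.eq_empty_or_nonempty with rfl | ⟨x₀, hx₀⟩
  · simp only [Finset.card_empty, Nat.cast_zero]; positivity
  borelize E
  let μ : Measure E := Measure.addHaar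
  have hη2 : 0 < η / 2 := by positivity
  have hρ : 0 < R + η / 2 := by positivity
  have D : Set.Pairwise (s : Set E) (Function.onFun Disjoint fun c => Metric.ball c (η / 2)) := by
    intro x hx y hy hxy
    apply Metric.ball_disjoint_ball
    have := h x hx y hy hxy
    linarith
  -- The enclosing ball is centred at a point of `s`, so the volume ratio is that of radii R + η/2
  -- and η/2.
  have hsub : (⋃ c ∈ s, Metric.ball c (η / 2)) ⊆ Metric.ball x₀ (R + η / 2) := by
    refine Set.iUnion₂_subset fun x hx => Metric.ball_subset_ball' ?_
    have := hs x hx x₀ hx₀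
    linarith
  have I : (s.card : ℝ≥0∞) * ENNReal.ofReal ((η / 2) ^ Module.finrank ℝ E) * μ (Metric.ball 0 1) ≤
      ENNReal.ofReal ((R + η / 2) ^ Module.finrank ℝ E) * μ (Metric.ball 0 1) :=
    calc
      _ = μ (⋃ c ∈ s, Metric.ball c (η / 2)) := by
        rw [measure_biUnion_finset D fun c _ => measurableSet_ball]
        simp only [μ.addHaar_ball_of_pos _ hη2, Finset.sum_const, nsmul_eq_mul, mul_assoc]
      _ ≤ μ (Metric.ball x₀ (R + η / 2)) := measure_mono hsub
      _ = _ := by simp only [μ.addHaar_ball_of_pos _ hρ]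
  have J := (ENNReal.mul_le_mul_iff_left (Metric.measure_ball_pos _ _ zero_lt_one).ne'
    measure_ball_lt_top.ne).1 I
  have K := ENNReal.toReal_le_of_le_ofReal (pow_nonneg hρ.le _) J
  rw [ENNReal.toReal_mul, ENNReal.toReal_natCast, ENNReal.toReal_ofReal (by positivity),
    ← le_div_iff₀ (by positivity), ← div_pow] at K
  have hq : (R + η / 2) / (η / 2) = 1 + 2 * R / η := by
    field_simp
    ring
  rwa [hq] at K

/-- A set all of whose separated finite subsets have at most `N` elements has a finite net. -/
theorem exists_finset_net_of_card_le {X : Type*} [PseudoMetricSpace X] (S : Set X) {η : ℝ} (hη : 0 ≤ η) {N : ℝ}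
    (h : ∀ s : Finset X, (s : Set X) ⊆ S →
      (∀ x ∈ s, ∀ y ∈ s, x ≠ y → η ≤ dist x y) → (s.card : ℝ) ≤ N) :
    ∃ s : Finset X, (s : Set X) ⊆ S ∧ (s.card : ℝ) ≤ N ∧ ∀ x ∈ S, ∃ y ∈ s, dist x y ≤ η := by
  classical
  let T : Set ℕ := {n | ∃ s : Finset X, (s : Set X) ⊆ S ∧
    (∀ x ∈ s, ∀ y ∈ s, x ≠ y → η ≤ dist x y) ∧ s.card = n}
  have hTne : T.Nonempty := ⟨0, ∅, by simp, by simp, by simp⟩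
  have hTb : BddAbove T := by
    refine ⟨⌊N⌋₊, ?_⟩
    rintro _ ⟨s, h1, h2, rfl⟩
    exact Nat.le_floor (h s h1 h2)
  -- A separated set of maximal cardinality is a net: a point far from all of it could be added.
  obtain ⟨s, h1, h2, h3⟩ := Nat.sSup_mem hTne hTb
  refine ⟨s, h1, h s h1 h2, fun x hx => ?_⟩
  by_contra! hc
  by_cases hxs : x ∈ s
  · exact (hc x hxs).not_ge (by rwa [dist_self])
  · have hmem : (insert x s).card ∈ T := by
      refine ⟨insert x s, ?_, ?_, rfl⟩
      · rw [Finset.coe_insert]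
        exact Set.insert_subset hx h1
      · intro u hu v hv huv
        rw [Finset.mem_insert] at hu hv
        rcases hu with rfl | hu <;> rcases hv with rfl | hv
        · exact absurd rfl huv
        · exact (hc v hv).le
        · rw [dist_comm]; exact (hc u hu).le
        · exact h2 u hu v hv huv
    have := le_csSup hTb hmem
    rw [Finset.card_insert_of_notMem hxs, ← h3] at this
    omega

/-- Restriction of a vector to the coordinates that a mask keeps. -/
noncomputable def restrictMask {p : ℕ} (m : Mask p) (w : Euc p) :
    EuclideanSpace ℝ {i // m i = true} :=
  WithLp.toLp 2 fun i => w i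

/-- Pruned coordinates contribute nothing, so the volume bound can be applied in dimension `m.size`
instead of p. -/
theorem dist_restrictMask {p : ℕ} (m : Mask p) {w₁ w₂ : Euc p} (h₁ : ∀ i, m i = false → w₁ i = 0)
    (h₂ : ∀ i, m i = false → w₂ i = 0) :
    dist (restrictMask m w₁) (restrictMask m w₂) = dist w₁ w₂ := by
  rw [EuclideanSpace.dist_eq, EuclideanSpace.dist_eq]
  congr 1
  simp only [restrictMask]
  rw [← Finset.sum_subtype (Finset.univ.filter fun i => m i = true) (by simp)
    (fun i => dist (w₁ i) (w₂ i) ^ 2)]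
  refine Finset.sum_subset (Finset.subset_univ _) fun i _ hi => ?_
  have hm : m i = false := by simpa using hi
  simp [h₁ i hm, h₂ i hm]

/-- Nets of sets of masked weights, in the scale of a Lipschitz parametrization. -/
theorem exists_finset_net_mask {p : ℕ} (m : Mask p) {S : Set (Euc p)} {R J ρ : ℝ} (hR : 0 ≤ R)
    (hJ : 0 ≤ J) (hρ : 0 < ρ) (hS : ∀ w ∈ S, ∀ i, m i = false → w i = 0)
    (hdiam : ∀ x ∈ S, ∀ y ∈ S, dist x y ≤ R) :
    ∃ s : Finset (Euc p), (s : Set (Euc p)) ⊆ S ∧ (s.card : ℝ) ≤ (1 + 2 * R * J / ρ) ^ m.size ∧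
      ∀ x ∈ S, ∃ y ∈ s, J * dist x y ≤ ρ := by
  classical
  -- For J = 0 the scale ρ / J is meaningless, but a single point is a net.
  rcases hJ.eq_or_lt with rfl | hJ
  · rcases S.eq_empty_or_nonempty with rfl | ⟨x₀, hx₀⟩
    · exact ⟨∅, by simp, by simp, by simp⟩
    · exact ⟨{x₀}, by simpa using hx₀, by simp, fun x _ => ⟨x₀, by simp, by simpa using hρ.le⟩⟩
  have hη : 0 < ρ / J := by positivity
  have := exists_finset_net_of_card_le S (η := ρ / J) (N := (1 + 2 * R * J / ρ) ^ m.size) hη.le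
    fun s hsS hsep => by
      have hinj : Set.InjOn (restrictMask m) s := by
        intro x hx y hy hxy
        have := dist_restrictMask m (hS x (hsS hx)) (hS y (hsS hy))
        rw [hxy, dist_self] at this
        exact dist_eq_zero.1 this.symm
      have hcard := card_le_of_separated (s.image (restrictMask m)) hη hR
        (by
          simp only [Finset.mem_image]
          rintro _ ⟨x, hx, rfl⟩ _ ⟨y, hy, rfl⟩
          rw [dist_restrictMask m (hS x (hsS hx)) (hS y (hsS hy))]
          exact hdiam x (hsS hx) y (hsS hy))
        (by
          simp only [Finset.mem_image]
          rintro _ ⟨x, hx, rfl⟩ _ ⟨y, hy, rfl⟩ hne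
          rw [dist_restrictMask m (hS x (hsS hx)) (hS y (hsS hy))]
          exact hsep x hx y hy fun h => hne (by rw [h]))
      rw [Finset.card_image_of_injOn hinj, finrank_euclideanSpace, Fintype.card_subtype] at hcard
      rw [Mask.size, show 2 * R * J / ρ = 2 * R / (ρ / J) by field_simp]
      exact hcard
  obtain ⟨s, h1, h2, h3⟩ := this
  refine ⟨s, h1, h2, fun x hx => ?_⟩
  obtain ⟨y, hy, hxy⟩ := h3 x hx
  refine ⟨y, hy, ?_⟩
  rw [le_div_iff₀ hJ] at hxy
  linarith

end Covering

/-! ### Mutual information as the price of data-dependent choice. -/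

section Information

open InformationTheory

/-- The Donsker-Varadhan inequality, for bounded functions. -/
theorem integral_le_klDiv_add_log {α : Type*} [MeasurableSpace α] {μ ν : Measure α}
    [IsProbabilityMeasure μ] [IsProbabilityMeasure ν] (hac : μ ≪ ν) (hint : Integrable (llr μ ν) μ)
    {φ : α → ℝ} (hφ : Measurable φ) {B : ℝ} (hB : ∀ x, |φ x| ≤ B) :
    ∫ x, φ x ∂μ ≤ (klDiv μ ν).toReal + Real.log (∫ x, Real.exp (φ x) ∂ν) := by
  have hφμ : Integrable φ μ := Integrable.of_bound hφ.aestronglyMeasurable B (ae_of_all _ hB)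
  have hexp : Integrable (fun x => Real.exp (φ x)) ν :=
    Integrable.of_bound (hφ.exp).aestronglyMeasurable (Real.exp B) (ae_of_all _ fun x => by
      rw [Real.norm_eq_abs, Real.abs_exp]
      exact Real.exp_le_exp.2 ((le_abs_self _).trans (hB x)))
  -- Gibbs' inequality for μ against the tilted measure with density proportional to exp φ; tilting
  -- changes the divergence by log E exp φ - E φ.
  have := isProbabilityMeasure_tilted hexp
  have hac' : μ ≪ ν.tilted φ := hac.trans (absolutelyContinuous_tilted hexp)
  have h0 := integral_llr_add_sub_measure_univ_nonneg hac'
    (integrable_llr_tilted_right hac hφμ hint hexp)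
  rw [integral_llr_tilted_right hac hφμ hexp hint] at h0
  rw [toReal_klDiv_of_measure_eq hac (by simp)]
  simp at h0
  linarith

/-- The density lies in [0, C], where the continuous function `klFun` is bounded. -/
theorem integrable_llr_of_le_smul {α : Type*} [MeasurableSpace α] {μ ν : Measure α}
    [IsFiniteMeasure μ] [IsFiniteMeasure ν] {C : ℝ≥0} (h : μ ≤ C • ν) :
    μ ≪ ν ∧ Integrable (llr μ ν) μ := by
  have hac : μ ≪ ν := (Measure.absolutelyContinuous_of_le h).trans
    (Measure.smul_absolutelyContinuous)
  refine ⟨hac, ?_⟩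
  rw [← integrable_klFun_rnDeriv_iff hac]
  have hC : ∀ᵐ x ∂ν, μ.rnDeriv ν x ≤ C := by
    refine ae_le_of_forall_setLIntegral_le_of_sigmaFinite (Measure.measurable_rnDeriv μ ν)
      fun s _ _ => (Measure.setLIntegral_rnDeriv_le s).trans ((h s).trans ?_)
    rw [lintegral_const, Measure.restrict_apply_univ, Measure.smul_apply, ENNReal.smul_def,
      smul_eq_mul]
  obtain ⟨B, hB⟩ := (isCompact_Icc (a := (0 : ℝ)) (b := C)).exists_bound_of_continuousOn
    (continuous_klFun.continuousOn)
  refine Integrable.of_bound ?_ B ?_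
  · exact (measurable_klFun.comp (Measure.measurable_rnDeriv μ ν).ennreal_toReal).aestronglyMeasurable
  · filter_upwards [hC] with x hx
    exact hB _ ⟨ENNReal.toReal_nonneg, ENNReal.toReal_le_of_le_ofReal C.2 (by simpa using hx)⟩

/-- The joint law of a random variable with finitely many values and another one is dominated by a
multiple of the product of the marginal laws. -/
theorem exists_map_prod_le_smul {Ω α β : Type*} [MeasurableSpace Ω] [MeasurableSpace α]
    [MeasurableSpace β] [Fintype α] [MeasurableSingletonClass α] (P : Measure Ω)
    [IsProbabilityMeasure P] {A : Ω → α} {B : Ω → β} (hA : Measurable A) (hB : Measurable B) :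
    ∃ C : ℝ≥0, P.map (fun ω => (A ω, B ω)) ≤ C • (P.map A).prod (P.map B) := by
  classical
  have : IsProbabilityMeasure (P.map A) := Measure.isProbabilityMeasure_map hA.aemeasurable
  have : IsProbabilityMeasure (P.map B) := Measure.isProbabilityMeasure_map hB.aemeasurable
  -- P(A = a, B ∈ S) ≤ P(B ∈ S), which is P(A = a)⁻¹ times the product mass. Null values of A add
  -- 0⁻¹ = 0 to the constant and no mass to the joint law.
  refine ⟨∑ a, ((P.map A {a}).toNNReal)⁻¹, Measure.le_iff.2 fun s hs => ?_⟩
  set C : ℝ≥0 := ∑ a, ((P.map A {a}).toNNReal)⁻¹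
  rw [Measure.map_apply (hA.prodMk hB) hs]
  have hpre : ∀ a : α, MeasurableSet (Prod.mk a ⁻¹' s) := fun a => measurable_prodMk_left hs
  have h1 : P ((fun ω => (A ω, B ω)) ⁻¹' s) =
      ∑ a, P (A ⁻¹' {a} ∩ B ⁻¹' (Prod.mk a ⁻¹' s)) := by
    rw [← measure_biUnion_finset]
    · congr 1
      ext ω
      simp
    · intro a _ b _ hab
      refine Set.disjoint_left.2 fun ω h1 h2 => hab ?_
      rw [← h1.1, ← h2.1]
    · exact fun a _ => (hA (measurableSet_singleton a)).inter (hB (hpre a))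
  rw [h1, Measure.smul_apply, Measure.prod_apply hs, lintegral_fintype, ENNReal.smul_def,
    smul_eq_mul, Finset.mul_sum]
  refine Finset.sum_le_sum fun a _ => ?_
  by_cases h0 : P.map A {a} = 0
  · rw [Measure.map_apply hA (measurableSet_singleton a)] at h0
    rw [measure_mono_null Set.inter_subset_left h0]
    exact zero_le
  · have hle : ((P.map A {a}).toNNReal)⁻¹ ≤ C :=
      Finset.single_le_sum (f := fun a => ((P.map A {a}).toNNReal)⁻¹) (fun _ _ => zero_le)
        (Finset.mem_univ a)
    have hne : (P.map A {a}).toNNReal ≠ 0 := by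
      simp [ENNReal.toNNReal_eq_zero_iff, h0]
    have hone : (1 : ℝ≥0∞) ≤ C * P.map A {a} := by
      calc (1 : ℝ≥0∞) = ((((P.map A {a}).toNNReal)⁻¹ * (P.map A {a}).toNNReal : ℝ≥0) : ℝ≥0∞) := by
            rw [inv_mul_cancel₀ hne]; simp
        _ ≤ C * P.map A {a} := by
            rw [ENNReal.coe_mul, ENNReal.coe_toNNReal (measure_ne_top _ _)]
            gcongr
    calc P (A ⁻¹' {a} ∩ B ⁻¹' (Prod.mk a ⁻¹' s)) ≤ P (B ⁻¹' (Prod.mk a ⁻¹' s)) :=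
          measure_mono Set.inter_subset_right
      _ = 1 * P.map B (Prod.mk a ⁻¹' s) := by rw [one_mul, Measure.map_apply hB (hpre a)]
      _ ≤ (C * P.map A {a}) * P.map B (Prod.mk a ⁻¹' s) := by gcongr
      _ = _ := by ring

/-- If `D` avoids each `A a` up to probability `exp (s a - τ)`, then a choice `M` of `a` that
depends on `D` can make `D ∈ A M` likely only at the price of mutual information. -/
theorem measureReal_mem_le_mutualInfo {Ω α β : Type*} [MeasurableSpace Ω] [MeasurableSpace α]
    [MeasurableSpace β] [Fintype α] [MeasurableSingletonClass α] (P : Measure Ω)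
    [IsProbabilityMeasure P] {M : Ω → α} {D : Ω → β} (hM : Measurable M) (hD : Measurable D)
    {A : α → Set β} (hA : ∀ a, MeasurableSet (A a)) {s : α → ℝ} (hs : ∀ a, 0 ≤ s a) {τ : ℝ}
    (hτ : 0 ≤ τ) (hle : ∀ a, (P.map D).real (A a) ≤ Real.exp (s a - τ)) :
    τ / 2 * P.real {ω | D ω ∈ A (M ω)} ≤
      (mutualInfoBits P M D).toReal * Real.log 2 + ∫ ω, s (M ω) ∂P + Real.exp (-(τ / 2)) := by
  classical
  have hPD : IsProbabilityMeasure (P.map D) := Measure.isProbabilityMeasure_map hD.aemeasurable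
  have hPM : IsProbabilityMeasure (P.map M) := Measure.isProbabilityMeasure_map hM.aemeasurable
  have hMD : Measurable fun ω => (M ω, D ω) := hM.prodMk hD
  have hPMD : IsProbabilityMeasure (P.map fun ω => (M ω, D ω)) :=
    Measure.isProbabilityMeasure_map hMD.aemeasurable
  obtain ⟨C, hC⟩ := exists_map_prod_le_smul P hM hD
  obtain ⟨hac, hint⟩ := integrable_llr_of_le_smul hC
  have hsm : Measurable s := measurable_of_finite s
  have hS : MeasurableSet {z : α × β | z.2 ∈ A z.1} := by
    have : {z : α × β | z.2 ∈ A z.1} = ⋃ a, ({a} : Set α) ×ˢ A a := by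
      ext ⟨a, b⟩
      simp
    rw [this]
    exact MeasurableSet.iUnion fun a => (measurableSet_singleton a).prod (hA a)
  -- Only half of τ is spent on the test function: the other half makes E exp φ - 1 at most
  -- exp(-τ/2) under the product law. Truncation at 0 keeps φ between 0 and τ/2.
  let φ : α × β → ℝ := {z : α × β | z.2 ∈ A z.1}.indicator fun z => max (τ / 2 - s z.1) 0
  have hφ : Measurable φ :=
    (((measurable_const.sub (hsm.comp measurable_fst)).max measurable_const).indicator hS)
  have hφ0 : ∀ z, 0 ≤ φ z := fun z => Set.indicator_nonneg (fun _ _ => le_max_right _ _) z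
  have hφB : ∀ z, φ z ≤ τ / 2 := fun z => by
    refine Set.indicator_apply_le' (fun _ => max_le ?_ (by positivity)) fun _ => by positivity
    linarith [hs z.1]
  have hφabs : ∀ z, |φ z| ≤ τ / 2 := fun z => by rw [abs_of_nonneg (hφ0 z)]; exact hφB z
  have hDV := integral_le_klDiv_add_log hac hint hφ hφabs
  have hkl : (klDiv (P.map fun ω => (M ω, D ω)) ((P.map M).prod (P.map D))).toReal =
      (mutualInfoBits P M D).toReal * Real.log 2 := by
    have hl : 0 < Real.log 2 := Real.log_pos (by norm_num)
    rw [mutualInfoBits, ENNReal.toReal_div, ENNReal.toReal_ofReal hl.le, div_mul_cancel₀ _ hl.ne']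
  have hexpint : Integrable (fun z => Real.exp (φ z)) ((P.map M).prod (P.map D)) :=
    Integrable.of_bound (hφ.exp).aestronglyMeasurable (Real.exp (τ / 2)) (ae_of_all _ fun x => by
      rw [Real.norm_eq_abs, Real.abs_exp]
      exact Real.exp_le_exp.2 (hφB x))
  have hinner : ∀ a, ∫ b, Real.exp (φ (a, b)) ∂(P.map D) ≤ 1 + Real.exp (-(τ / 2)) := by
    intro a
    have hpt : ∀ b, Real.exp (φ (a, b)) ≤
        1 + (A a).indicator (fun _ => Real.exp (max (τ / 2 - s a) 0) - 1) b := by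
      intro b
      by_cases hb : b ∈ A a
      · have : φ (a, b) = max (τ / 2 - s a) 0 :=
          Set.indicator_of_mem (s := {z : α × β | z.2 ∈ A z.1}) (a := (a, b)) hb _
        rw [this, Set.indicator_of_mem hb]
        linarith
      · have : φ (a, b) = 0 :=
          Set.indicator_of_notMem (s := {z : α × β | z.2 ∈ A z.1}) (a := (a, b)) hb _
        rw [this, Set.indicator_of_notMem hb]
        simp
    have hi : Integrable (fun b => (A a).indicator
        (fun _ => Real.exp (max (τ / 2 - s a) 0) - 1) b) (P.map D) :=
      (integrable_const _).indicator (hA a)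
    calc ∫ b, Real.exp (φ (a, b)) ∂(P.map D)
        ≤ ∫ b, (1 + (A a).indicator (fun _ => Real.exp (max (τ / 2 - s a) 0) - 1) b) ∂(P.map D) :=
          integral_mono_of_nonneg (ae_of_all _ fun b => (Real.exp_pos _).le)
            ((integrable_const _).add hi) (ae_of_all _ hpt)
      _ = 1 + (P.map D).real (A a) * (Real.exp (max (τ / 2 - s a) 0) - 1) := by
          rw [integral_add (integrable_const _) hi, integral_indicator_const _ (hA a)]
          simp
      _ ≤ 1 + Real.exp (-(τ / 2)) := by
          gcongr
          rcases le_total (τ / 2 - s a) 0 with h | h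
          · rw [max_eq_right h]
            simp [Real.exp_nonneg]
          · rw [max_eq_left h]
            calc (P.map D).real (A a) * (Real.exp (τ / 2 - s a) - 1)
                ≤ (P.map D).real (A a) * Real.exp (τ / 2 - s a) := by
                  gcongr
                  linarith
              _ ≤ Real.exp (s a - τ) * Real.exp (τ / 2 - s a) := by
                  gcongr
                  exact hle a
              _ = Real.exp (-(τ / 2)) := by rw [← Real.exp_add]; congr 1; ring
  have hlog : Real.log (∫ z, Real.exp (φ z) ∂((P.map M).prod (P.map D))) ≤
      Real.exp (-(τ / 2)) := by
    have hle' : ∫ z, Real.exp (φ z) ∂((P.map M).prod (P.map D)) ≤ 1 + Real.exp (-(τ / 2)) := by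
      rw [integral_prod _ hexpint]
      calc ∫ a, ∫ b, Real.exp (φ (a, b)) ∂(P.map D) ∂(P.map M)
          ≤ ∫ _, (1 + Real.exp (-(τ / 2))) ∂(P.map M) :=
            integral_mono hexpint.integral_prod_left (integrable_const _) hinner
        _ = _ := by simp
    have hpos : 0 < ∫ z, Real.exp (φ z) ∂((P.map M).prod (P.map D)) := integral_exp_pos hexpint
    linarith [Real.log_le_sub_one_of_pos hpos]
  have hleft : τ / 2 * P.real {ω | D ω ∈ A (M ω)} - ∫ ω, s (M ω) ∂P ≤
      ∫ z, φ z ∂(P.map fun ω => (M ω, D ω)) := by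
    rw [integral_map hMD.aemeasurable hφ.aestronglyMeasurable]
    have hE : MeasurableSet {ω | D ω ∈ A (M ω)} := hMD hS
    have hsi : Integrable (fun ω => s (M ω)) P := by
      obtain ⟨B, hB⟩ := (Set.finite_range s).bddAbove
      refine Integrable.of_bound (hsm.comp hM).aestronglyMeasurable B (ae_of_all _ fun ω => ?_)
      rw [Real.norm_eq_abs, abs_of_nonneg (hs _)]
      exact hB ⟨_, rfl⟩
    have hi : Integrable ({ω | D ω ∈ A (M ω)}.indicator fun _ => τ / 2) P :=
      (integrable_const _).indicator hE
    have heq : τ / 2 * P.real {ω | D ω ∈ A (M ω)} =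
        ∫ ω, {ω | D ω ∈ A (M ω)}.indicator (fun _ => τ / 2) ω ∂P := by
      rw [integral_indicator_const _ hE, smul_eq_mul, mul_comm]
    rw [heq, ← integral_sub hi hsi]
    refine integral_mono (hi.sub hsi) (Integrable.of_bound (hφ.comp hMD).aestronglyMeasurable
      (τ / 2) (ae_of_all _ fun ω => hφabs _)) fun ω => ?_
    by_cases hω : D ω ∈ A (M ω)
    · have : φ (M ω, D ω) = max (τ / 2 - s (M ω)) 0 :=
        Set.indicator_of_mem (s := {z : α × β | z.2 ∈ A z.1}) (a := (M ω, D ω)) hω _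
      simp only [this, Set.indicator_of_mem (s := {ω | D ω ∈ A (M ω)}) hω]
      exact le_max_left _ _
    · simp only [Set.indicator_of_notMem (s := {ω | D ω ∈ A (M ω)}) hω]
      linarith [hφ0 (M ω, D ω), hs (M ω)]
  rw [hkl] at hDV
  linarith

end Information

/-! ### From Gaussian tails to sub-Gaussian products. -/

section ExponentialMoments

/-- The linear term integrates to zero for a centered variable, leaving a square-exponential moment.
-/
theorem exp_le_add_exp_sq (x : ℝ) : Real.exp x ≤ x + Real.exp (x ^ 2) := by
  have h1 := Real.add_one_le_exp (x ^ 2)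
  rcases le_or_gt |x| 1 with h | h
  · have := (abs_le.1 (Real.abs_exp_sub_one_sub_id_le h)).2
    linarith
  · rcases lt_abs.1 h with h | h
    · have : Real.exp x ≤ Real.exp (x ^ 2) := Real.exp_le_exp.2 (by nlinarith)
      linarith
    · have : Real.exp x ≤ 1 := Real.exp_le_one_iff.2 (by linarith)
      nlinarith

theorem lintegral_Ioi_two_mul_inv_sq :
    ∫⁻ t in Set.Ioi (0 : ℝ), ENNReal.ofReal (2 * ((1 + t) ^ 2)⁻¹) = 2 := by
  have hderiv : ∀ t ∈ Set.Ici (0 : ℝ),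
      HasDerivAt (fun t : ℝ => -2 * (1 + t)⁻¹) (2 * ((1 + t) ^ 2)⁻¹) t := by
    intro t ht
    have ht' : (1 + t) ≠ 0 := by
      have : (0 : ℝ) ≤ t := ht
      positivity
    have := ((((hasDerivAt_id t).const_add 1).inv ht').const_mul (-2))
    refine this.congr_deriv ?_
    simp only [id]
    ring
  have hpos : ∀ t ∈ Set.Ioi (0 : ℝ), (0 : ℝ) ≤ 2 * ((1 + t) ^ 2)⁻¹ := fun t _ => by positivity
  have hlim : Filter.Tendsto (fun t : ℝ => -2 * (1 + t)⁻¹) Filter.atTop (nhds 0) := by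
    have : Filter.Tendsto (fun t : ℝ => (1 + t)⁻¹) Filter.atTop (nhds 0) :=
      tendsto_inv_atTop_zero.comp (Filter.tendsto_atTop_add_const_left _ _ Filter.tendsto_id)
    simpa using this.const_mul (-2)
  have hint := integrableOn_Ioi_deriv_of_nonneg'
    (fun t ht => hderiv t ht) hpos hlim
  have hval := integral_Ioi_of_hasDerivAt_of_nonneg' (fun t ht => hderiv t ht) hpos hlim
  rw [← ofReal_integral_eq_lintegral_ofReal hint
    ((ae_restrict_mem measurableSet_Ioi).mono fun t ht => hpos t ht), hval]
  simp

/-- Gaussian tails give a square-exponential moment. -/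
theorem integral_exp_sq_le_of_tail {α : Type*} [MeasurableSpace α] {μ : Measure α}
    [IsProbabilityMeasure μ] {X : α → ℝ} (hX : Measurable X) {B : ℝ} (hB : ∀ x, |X x| ≤ B) {v : ℝ}
    (hv : 0 < v)
    (htail : ∀ t : ℝ, 0 ≤ t → μ.real {x | t ≤ |X x|} ≤ 2 * Real.exp (-(t ^ 2 / (2 * v)))) :
    ∫ x, Real.exp (X x ^ 2 / (4 * v)) ∂μ ≤ 3 := by
  have hm : Measurable fun x => Real.exp (X x ^ 2 / (4 * v)) := by fun_prop
  have hint : Integrable (fun x => Real.exp (X x ^ 2 / (4 * v))) μ := by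
    refine Integrable.of_bound hm.aestronglyMeasurable (Real.exp (B ^ 2 / (4 * v)))
      (ae_of_all _ fun x => ?_)
    rw [Real.norm_eq_abs, Real.abs_exp]
    have := sq_le_sq' (neg_le_of_abs_le (hB x)) (le_of_abs_le (hB x))
    gcongr
  have hnn : ∀ x, 0 ≤ Real.exp (X x ^ 2 / (4 * v)) - 1 := fun x => by
    have : (0 : ℝ) ≤ X x ^ 2 / (4 * v) := by positivity
    linarith [Real.one_le_exp this]
  have key : ∫⁻ x, ENNReal.ofReal (Real.exp (X x ^ 2 / (4 * v)) - 1) ∂μ ≤ 2 := by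
    rw [lintegral_eq_lintegral_meas_le μ (ae_of_all _ hnn) (hm.sub_const 1).aemeasurable,
      ← lintegral_Ioi_two_mul_inv_sq]
    refine setLIntegral_mono' measurableSet_Ioi fun t ht => ?_
    have ht : 0 < t := ht
    have hl : 0 ≤ Real.log (1 + t) := Real.log_nonneg (by linarith)
    -- In the layer-cake formula the tail at √(4v log(1 + t)) is 2 (1 + t)⁻², whose integral is 2.
    have hsub : {x | t ≤ Real.exp (X x ^ 2 / (4 * v)) - 1} ⊆
        {x | √(4 * v * Real.log (1 + t)) ≤ |X x|} := by
      intro x hx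
      have hx : 1 + t ≤ Real.exp (X x ^ 2 / (4 * v)) := by
        have : t ≤ Real.exp (X x ^ 2 / (4 * v)) - 1 := hx
        linarith
      have := (Real.log_le_iff_le_exp (by linarith)).2 hx
      rw [le_div_iff₀ (by positivity)] at this
      refine Real.sqrt_le_iff.2 ⟨abs_nonneg _, ?_⟩
      rw [sq_abs]
      linarith
    refine (measure_mono hsub).trans ?_
    rw [← ofReal_measureReal]
    refine ENNReal.ofReal_le_ofReal ((htail _ (Real.sqrt_nonneg _)).trans_eq ?_)
    rw [Real.sq_sqrt (by positivity)]
    have : -(4 * v * Real.log (1 + t) / (2 * v)) = -(Real.log ((1 + t) ^ 2)) := by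
      rw [Real.log_pow]
      field_simp
      push_cast
      ring
    rw [this, Real.exp_neg, Real.exp_log (by positivity)]
  have hint' : Integrable (fun x => Real.exp (X x ^ 2 / (4 * v)) - 1) μ :=
    hint.sub (integrable_const 1)
  rw [← ofReal_integral_eq_lintegral_ofReal hint' (ae_of_all _ hnn),
    integral_sub hint (integrable_const 1)] at key
  have := (ENNReal.ofReal_le_iff_le_toReal (by simp)).1 key
  simp at this
  linarith

/-- The product of a bounded noise and an orthogonal factor with a square-exponential moment is
sub-Gaussian. -/
theorem hasSubgaussianMGF_mul {α : Type*} [MeasurableSpace α] {ν : Measure α}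
    [IsProbabilityMeasure ν] {Z H : α → ℝ} (hZ : Measurable Z) (hH : Measurable H)
    (hZ2 : ∀ᵐ x ∂ν, |Z x| ≤ 2) {B : ℝ} (hB : ∀ x, |H x| ≤ B) {v : ℝ≥0} (hv : 0 < v)
    (h0 : ∫ x, Z x * H x ∂ν = 0) (hexp : ∫ x, Real.exp (H x ^ 2 / (4 * v)) ∂ν ≤ 3) :
    HasSubgaussianMGF (fun x => Z x * H x) (64 * v) ν := by
  have hv' : (0 : ℝ) < v := hv
  have hZH : ∀ᵐ x ∂ν, |Z x * H x| ≤ 2 * B := by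
    filter_upwards [hZ2] with x hx
    rw [abs_mul]
    exact mul_le_mul hx (hB x) (abs_nonneg _) (by norm_num)
  have hm : Measurable fun x => Z x * H x := hZ.mul hH
  have hiZH : Integrable (fun x => Z x * H x) ν := Integrable.of_bound hm.aestronglyMeasurable _ hZH
  have hint : ∀ t : ℝ, Integrable (fun x => Real.exp (t * (Z x * H x))) ν := fun t => by
    refine Integrable.of_bound (hm.const_mul t).exp.aestronglyMeasurable
      (Real.exp (|t| * (2 * B))) ?_
    filter_upwards [hZH] with x hx
    rw [Real.norm_eq_abs, Real.abs_exp, Real.exp_le_exp]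
    refine (le_abs_self _).trans ?_
    rw [abs_mul]
    gcongr
  have hiE : Integrable (fun x => Real.exp (H x ^ 2 / (4 * v))) ν := by
    refine Integrable.of_bound (by fun_prop) (Real.exp (B ^ 2 / (4 * v))) (ae_of_all _ fun x => ?_)
    rw [Real.norm_eq_abs, Real.abs_exp]
    have := sq_le_sq' (neg_le_of_abs_le (hB x)) (le_of_abs_le (hB x))
    gcongr
  refine ⟨hint, fun t => ?_⟩
  have hsq : ∀ x, |Z x| ≤ 2 → (Z x) ^ 2 ≤ 4 := fun x hx => by
    have := abs_le.1 hx
    nlinarith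
  have hgoal : ((64 * v : ℝ≥0) : ℝ) * t ^ 2 / 2 = 32 * v * t ^ 2 := by push_cast; ring
  rw [mgf, hgoal]
  -- For small t, (tZH)² ≤ 16vt² · H²/(4v) and convexity of exp on [0, H²/(4v)] gives at most 1 +
  -- 32vt². For large t, tZH ≤ 4vt² + H²/(4v) by AM-GM, and the moment 3 is absorbed because 28vt² >
  -- 7/4.
  rcases le_or_gt (16 * v * t ^ 2) 1 with hs | hs
  · have hpt : ∀ᵐ x ∂ν, Real.exp (t * (Z x * H x)) ≤
        t * (Z x * H x) + ((1 - 16 * v * t ^ 2) + 16 * v * t ^ 2 *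
          Real.exp (H x ^ 2 / (4 * v))) := by
      filter_upwards [hZ2] with x hx
      refine (exp_le_add_exp_sq _).trans ?_
      gcongr
      have h1 : (t * (Z x * H x)) ^ 2 ≤ 16 * v * t ^ 2 * (H x ^ 2 / (4 * v)) := by
        have : 16 * v * t ^ 2 * (H x ^ 2 / (4 * v)) = 4 * (t ^ 2 * H x ^ 2) := by
          field_simp
          ring
        rw [this]
        have := mul_le_mul_of_nonneg_right (hsq x hx) (by positivity : 0 ≤ t ^ 2 * H x ^ 2)
        nlinarith
      have hc := convexOn_exp.2 (Set.mem_univ (0 : ℝ)) (Set.mem_univ (H x ^ 2 / (4 * v)))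
        (by linarith : (0 : ℝ) ≤ 1 - 16 * v * t ^ 2) (by positivity : (0 : ℝ) ≤ 16 * v * t ^ 2)
        (by ring)
      simp only [smul_eq_mul, mul_zero, zero_add, Real.exp_zero, mul_one] at hc
      exact (Real.exp_le_exp.2 h1).trans hc
    calc ∫ x, Real.exp (t * (Z x * H x)) ∂ν
        ≤ ∫ x, (t * (Z x * H x) + ((1 - 16 * v * t ^ 2) + 16 * v * t ^ 2 *
          Real.exp (H x ^ 2 / (4 * v)))) ∂ν :=
          integral_mono_ae (hint t) ((hiZH.const_mul t).add ((integrable_const _).add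
            (hiE.const_mul _))) hpt
      _ = (1 - 16 * v * t ^ 2) + 16 * v * t ^ 2 * ∫ x, Real.exp (H x ^ 2 / (4 * v)) ∂ν := by
          have hi : Integrable (fun x => (1 - 16 * v * t ^ 2) + 16 * v * t ^ 2 *
              Real.exp (H x ^ 2 / (4 * v))) ν := (integrable_const _).add (hiE.const_mul _)
          rw [integral_add (hiZH.const_mul t) hi,
            integral_add (integrable_const _) (hiE.const_mul _), integral_const_mul,
            integral_const_mul, h0]
          simp
      _ ≤ (1 - 16 * v * t ^ 2) + 16 * v * t ^ 2 * 3 := by gcongr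
      _ ≤ Real.exp (32 * v * t ^ 2) := by
          have := Real.add_one_le_exp (32 * v * t ^ 2)
          linarith
  · have hpt : ∀ᵐ x ∂ν, Real.exp (t * (Z x * H x)) ≤
        Real.exp (4 * v * t ^ 2) * Real.exp (H x ^ 2 / (4 * v)) := by
      filter_upwards [hZ2] with x hx
      rw [← Real.exp_add, Real.exp_le_exp]
      have h4 : H x ^ 2 / (4 * v) = v * (H x / (2 * v)) ^ 2 := by
        field_simp
        ring
      have h5 : t * (Z x * H x) = 2 * v * ((t * Z x) * (H x / (2 * v))) := by
        field_simp
      rw [h4, h5]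
      have h6 := mul_le_mul_of_nonneg_left (hsq x hx) (by positivity : 0 ≤ v * t ^ 2)
      have h7 := mul_nonneg hv'.le (sq_nonneg (t * Z x - H x / (2 * v)))
      nlinarith
    have h3 : (3 : ℝ) ≤ Real.exp (28 * v * t ^ 2) := by
      have h1 : Real.exp 1 ≤ Real.exp (28 * v * t ^ 2 - 3 / 4) := Real.exp_le_exp.2 (by linarith)
      have h2 := Real.add_one_le_exp (3 / 4 : ℝ)
      have h3 : Real.exp (28 * v * t ^ 2) =
          Real.exp (28 * v * t ^ 2 - 3 / 4) * Real.exp (3 / 4) := by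
        rw [← Real.exp_add]; congr 1; ring
      have h4 := Real.exp_one_gt_d9
      rw [h3]
      nlinarith
    calc ∫ x, Real.exp (t * (Z x * H x)) ∂ν
        ≤ ∫ x, Real.exp (4 * v * t ^ 2) * Real.exp (H x ^ 2 / (4 * v)) ∂ν :=
          integral_mono_ae (hint t) (hiE.const_mul _) hpt
      _ = Real.exp (4 * v * t ^ 2) * ∫ x, Real.exp (H x ^ 2 / (4 * v)) ∂ν := integral_const_mul _ _
      _ ≤ Real.exp (4 * v * t ^ 2) * Real.exp (28 * v * t ^ 2) := by
          gcongr
          exact hexp.trans h3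
      _ = Real.exp (32 * v * t ^ 2) := by rw [← Real.exp_add]; congr 1; ring

end ExponentialMoments

/-! ### Mixtures through posterior membership weights. -/

section Mixtures

/-- Membership weights of a mixture: the densities of the weighted components. -/
theorem exists_mixture_weights {ι α : Type*} [Fintype ι] [MeasurableSpace α] (μ : Measure α)
    [IsProbabilityMeasure μ] (a : ι → ℝ) (ha : ∀ l, 0 ≤ a l) (μs : ι → Measure α)
    [∀ l, IsProbabilityMeasure (μs l)] (hμ : μ = ∑ l, ENNReal.ofReal (a l) • μs l) :
    ∃ r : ι → α → ℝ, (∀ l, Measurable (r l)) ∧ (∀ l x, 0 ≤ r l x) ∧ (∀ x, ∑ l, r l x = 1) ∧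
      ∀ l (φ : α → ℝ), ∫ x, r l x * φ x ∂μ = a l * ∫ x, φ x ∂(μs l) := by
  classical
  have : Nonempty ι := by
    by_contra h
    rw [not_nonempty_iff] at h
    have := IsProbabilityMeasure.ne_zero μ
    simp [hμ] at this
  let ρ : ι → Measure α := fun l => ENNReal.ofReal (a l) • μs l
  have hfin : ∀ l, IsFiniteMeasure (ρ l) := fun l => Measure.smul_finite _ ENNReal.ofReal_ne_top
  have hle : ∀ l, ρ l ≤ μ := fun l => by
    rw [hμ]
    exact Measure.le_iff.2 fun s _ => by
      rw [Measure.finsetSum_apply]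
      exact Finset.single_le_sum (f := fun l => ρ l s) (fun _ _ => zero_le) (Finset.mem_univ l)
  have hac : ∀ l, ρ l ≪ μ := fun l => Measure.absolutelyContinuous_of_le (hle l)
  have hsum : ∀ᵐ x ∂μ, ∑ l, (ρ l).rnDeriv μ x = 1 := by
    refine ae_eq_of_forall_setLIntegral_eq_of_sigmaFinite
      (Finset.measurable_fun_sum _ fun l _ => Measure.measurable_rnDeriv _ _)
      measurable_const fun s hs _ => ?_
    rw [lintegral_finsetSum _ fun l _ => Measure.measurable_rnDeriv _ _]
    simp only [Measure.setLIntegral_rnDeriv (hac _), lintegral_const, one_mul,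
      Measure.restrict_apply_univ]
    conv_rhs => rw [hμ, Measure.finsetSum_apply]
  have hsum' : ∀ᵐ x ∂μ, ∑ l, ((ρ l).rnDeriv μ x).toReal = 1 := by
    filter_upwards [hsum, ae_all_iff.2 fun l => (ρ l).rnDeriv_ne_top μ] with x hx hx'
    rw [← ENNReal.toReal_sum fun l _ => hx' l, hx, ENNReal.toReal_one]
  have hmeas : ∀ l, Measurable fun x => ((ρ l).rnDeriv μ x).toReal := fun l =>
    (Measure.measurable_rnDeriv _ _).ennreal_toReal
  have hset : MeasurableSet {x | ∑ l, ((ρ l).rnDeriv μ x).toReal = 1} :=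
    (Finset.measurable_fun_sum _ fun l _ => hmeas l) (measurableSet_singleton 1)
  -- On the null set where the densities do not sum to 1, uniform weights are used, so that the
  -- identities hold at every point.
  refine ⟨fun l x => if ∑ l, ((ρ l).rnDeriv μ x).toReal = 1 then ((ρ l).rnDeriv μ x).toReal
    else (Fintype.card ι : ℝ)⁻¹, fun l => Measurable.ite hset (hmeas l) measurable_const,
    fun l x => ?_, fun x => ?_, fun l φ => ?_⟩
  · dsimp only
    split_ifs
    · exact ENNReal.toReal_nonneg
    · positivity
  · by_cases h : ∑ l, ((ρ l).rnDeriv μ x).toReal = 1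
    · simp [h]
    · simp [h]
  · have h1 := integral_rnDeriv_smul (hac l) (f := φ)
    have h2 : ∫ x, φ x ∂(ρ l) = a l * ∫ x, φ x ∂(μs l) := by
      rw [integral_smul_measure, ENNReal.toReal_ofReal (ha l), smul_eq_mul]
    rw [← h2, ← h1]
    refine integral_congr_ae ?_
    filter_upwards [hsum'] with x hx
    simp [hx]

/-- The deviation of a function from its component means, averaged with the membership weights,
inherits the square-exponential moments of the components. -/
theorem integral_exp_sq_mixture_le {ι α : Type*} [Fintype ι] [MeasurableSpace α] {μ : Measure α}
    [IsProbabilityMeasure μ] {a : ι → ℝ} (ha : ∀ l, 0 ≤ a l) (ha1 : ∑ l, a l = 1)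
    {μs : ι → Measure α} {r : ι → α → ℝ} (hrm : ∀ l, Measurable (r l)) (hr0 : ∀ l x, 0 ≤ r l x)
    (hr1 : ∀ x, ∑ l, r l x = 1)
    (hr : ∀ l (φ : α → ℝ), ∫ x, r l x * φ x ∂μ = a l * ∫ x, φ x ∂(μs l))
    {X : ι → α → ℝ} (hX : ∀ l, Measurable (X l)) {B : ℝ} (hB : ∀ l x, |X l x| ≤ B) {v C : ℝ}
    (hv : 0 < v) (hC : ∀ l, ∫ x, Real.exp (X l x ^ 2 / (4 * v)) ∂(μs l) ≤ C) :
    ∫ x, Real.exp ((∑ l, r l x * X l x) ^ 2 / (4 * v)) ∂μ ≤ C := by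
  -- Jensen twice for the weights r_l(x): for the square, then for exp.
  have hpt : ∀ x, Real.exp ((∑ l, r l x * X l x) ^ 2 / (4 * v)) ≤
      ∑ l, r l x * Real.exp (X l x ^ 2 / (4 * v)) := by
    intro x
    have h1 := (Even.convexOn_pow (𝕜 := ℝ) (n := 2) even_two).map_sum_le (t := Finset.univ)
      (w := fun l => r l x) (p := fun l => X l x) (fun l _ => hr0 l x) (hr1 x) (by simp)
    have h2 := convexOn_exp.map_sum_le (t := Finset.univ)
      (w := fun l => r l x) (p := fun l => X l x ^ 2 / (4 * v)) (fun l _ => hr0 l x) (hr1 x)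
      (by simp)
    simp only [smul_eq_mul] at h1 h2
    refine le_trans (Real.exp_le_exp.2 ?_) h2
    calc _ ≤ (∑ l, r l x * X l x ^ 2) / (4 * v) := by gcongr
      _ = _ := by
        rw [Finset.sum_div]
        simp only [mul_div_assoc]
  have hr_le : ∀ l x, r l x ≤ 1 := fun l x => by
    rw [← hr1 x]
    exact Finset.single_le_sum (fun l _ => hr0 l x) (Finset.mem_univ l)
  have hint : ∀ l, Integrable (fun x => r l x * Real.exp (X l x ^ 2 / (4 * v))) μ := fun l => by
    have hXl := hX l
    have hrl := hrm l
    refine Integrable.of_bound (by fun_prop) (Real.exp (B ^ 2 / (4 * v))) (ae_of_all _ fun x => ?_)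
    rw [Real.norm_eq_abs, abs_mul, Real.abs_exp, abs_of_nonneg (hr0 l x)]
    have := sq_le_sq' (neg_le_of_abs_le (hB l x)) (le_of_abs_le (hB l x))
    calc _ ≤ 1 * Real.exp (B ^ 2 / (4 * v)) := by
          gcongr
          exact hr_le l x
      _ = _ := one_mul _
  calc ∫ x, Real.exp ((∑ l, r l x * X l x) ^ 2 / (4 * v)) ∂μ
      ≤ ∫ x, ∑ l, r l x * Real.exp (X l x ^ 2 / (4 * v)) ∂μ :=
        integral_mono_of_nonneg (ae_of_all _ fun x => (Real.exp_pos _).le)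
          (integrable_finsetSum _ fun l _ => hint l) (ae_of_all _ hpt)
    _ = ∑ l, a l * ∫ x, Real.exp (X l x ^ 2 / (4 * v)) ∂(μs l) := by
        rw [integral_finsetSum _ fun l _ => hint l]
        simp only [hr _ (fun x => Real.exp (X _ x ^ 2 / (4 * v)))]
    _ ≤ ∑ l, a l * C := Finset.sum_le_sum fun l _ => mul_le_mul_of_nonneg_left (hC l) (ha l)
    _ = C := by rw [← Finset.sum_mul, ha1, one_mul]

end Mixtures

/-! ### The regression function and orthogonality of the noise. -/

section Regression

/-- The events that depend on the covariate only. -/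
abbrev covariateAlgebra (d : ℕ) : MeasurableSpace (Euc d × ℝ) :=
  MeasurableSpace.comap (Prod.fst : Euc d × ℝ → Euc d) inferInstance

/-- The regression function `E[y | x]` of bounded labels: the noise `y - E[y | x]` is orthogonal to
every bounded function of `x`, and its second moment is the noise level. -/
theorem exists_regression {d : ℕ} (ν : Measure (Euc d × ℝ)) [IsProbabilityMeasure ν]
    (hν : ∀ᵐ z ∂ν, z.2 ∈ Set.Icc (-1 : ℝ) 1) :
    ∃ g : Euc d → ℝ, Measurable g ∧ (∀ x, |g x| ≤ 1) ∧
      (∀ u : Euc d → ℝ, Measurable u → ∀ B : ℝ, (∀ x, |u x| ≤ B) →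
        ∫ z, (z.2 - g z.1) * u z.1 ∂ν = 0) ∧
      noiseLevel ν = ∫ z, (z.2 - g z.1) ^ 2 ∂ν := by
  have hle : covariateAlgebra d ≤ Prod.instMeasurableSpace := measurable_fst.comap_le
  have hfst : Measurable[covariateAlgebra d] (Prod.fst : Euc d × ℝ → Euc d) := comap_measurable _
  have hsm : StronglyMeasurable[covariateAlgebra d] (ν[(Prod.snd : Euc d × ℝ → ℝ) | covariateAlgebra d]) :=
    stronglyMeasurable_condExp
  obtain ⟨g₀, hg₀, hg₀eq⟩ := hsm.exists_eq_measurable_comp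
  have hbd : ∀ᵐ z ∂ν, |z.2| ≤ 1 := hν.mono fun z hz => abs_le.2 hz
  have hint : Integrable (Prod.snd : Euc d × ℝ → ℝ) ν :=
    Integrable.of_bound measurable_snd.aestronglyMeasurable 1 hbd
  have hbd' : ∀ᵐ z ∂ν, |(ν[(Prod.snd : Euc d × ℝ → ℝ) | covariateAlgebra d]) z| ≤ 1 :=
    ae_bdd_abs_condExp_of_ae_bdd_abs (R := 1) hbd
  -- The conditional expectation is bounded only almost everywhere; truncation makes the bound hold
  -- everywhere.
  let g : Euc d → ℝ := fun x => max (-1) (min 1 (g₀ x))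
  have hg : Measurable g := measurable_const.max (measurable_const.min hg₀.measurable)
  have hg1 : ∀ x, |g x| ≤ 1 := fun x =>
    abs_le.2 ⟨le_max_left _ _, max_le (by norm_num) (min_le_left _ _)⟩
  have hgeq : (ν[(Prod.snd : Euc d × ℝ → ℝ) | covariateAlgebra d]) =ᵐ[ν] fun z => g z.1 := by
    filter_upwards [hbd'] with z hz
    rw [hg₀eq] at hz ⊢
    obtain ⟨h1, h2⟩ := abs_le.1 hz
    simp only [Function.comp_apply] at h1 h2 ⊢
    simp only [g]
    rw [min_eq_right h2, max_eq_right h1]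
  refine ⟨g, hg, hg1, fun u hu B hB => ?_, ?_⟩
  · have hum : StronglyMeasurable[covariateAlgebra d] fun z : Euc d × ℝ => u z.1 :=
      (hu.comp hfst).stronglyMeasurable
    have hi1 : Integrable (fun z : Euc d × ℝ => u z.1 * z.2) ν :=
      hint.bdd_mul (c := B) (hu.comp measurable_fst).aestronglyMeasurable
        (ae_of_all _ fun z => hB z.1)
    have hi2 : Integrable (fun z : Euc d × ℝ => u z.1 * g z.1) ν := by
      refine Integrable.bdd_mul (c := B) ?_ (hu.comp measurable_fst).aestronglyMeasurable
        (ae_of_all _ fun z => hB z.1)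
      exact Integrable.of_bound (hg.comp measurable_fst).aestronglyMeasurable 1
        (ae_of_all _ fun z => hg1 z.1)
    have hpull := condExp_mul_of_stronglyMeasurable_left (μ := ν) hum
      (g := (Prod.snd : Euc d × ℝ → ℝ)) hi1 hint
    have h1 : ∫ z, u z.1 * z.2 ∂ν = ∫ z, u z.1 * g z.1 ∂ν := by
      rw [← integral_condExp hle (f := fun z : Euc d × ℝ => u z.1 * z.2)]
      refine integral_congr_ae ?_
      filter_upwards [hpull, hgeq] with z hz hz'
      have : (ν[fun z : Euc d × ℝ => u z.1 * z.2 | covariateAlgebra d]) z =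
        u z.1 * (ν[(Prod.snd : Euc d × ℝ → ℝ) | covariateAlgebra d]) z := hz
      rw [this, hz']
    calc ∫ z, (z.2 - g z.1) * u z.1 ∂ν = ∫ z, (u z.1 * z.2 - u z.1 * g z.1) ∂ν := by
          congr 1
          ext z
          ring
      _ = 0 := by rw [integral_sub hi1 hi2, h1, sub_self]
  · rw [noiseLevel, condVar, integral_condExp hle]
    refine integral_congr_ae ?_
    filter_upwards [hgeq] with z hz
    simp [hz]

end Regression

/-! ### Hoeffding bounds for i.i.d. data. -/

section Concentration

variable {Ω β : Type*} [MeasurableSpace Ω] [MeasurableSpace β] {P : Measure Ω}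
  {ν : Measure β} {n : ℕ} {data : Fin n → Ω → β}

/-- Hoeffding's inequality for a sub-Gaussian statistic of i.i.d. data. -/
theorem measureReal_sum_ge_le (hdata : ∀ i, Measurable (data i)) (hind : iIndepFun data P)
    (hlaw : ∀ i, P.map (data i) = ν) {Y : β → ℝ} (hY : Measurable Y) {v : ℝ≥0}
    (hsub : HasSubgaussianMGF Y v ν) {θ : ℝ} (hθ : 0 ≤ θ) :
    P.real {ω | n * θ ≤ ∑ i, Y (data i ω)} ≤ Real.exp (-(n * θ ^ 2 / (2 * v))) := by
  have hind' : iIndepFun (fun i ω => Y (data i ω)) P := hind.comp (fun _ => Y) fun _ => hY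
  have hs : ∀ i ∈ Finset.univ, HasSubgaussianMGF (fun ω => Y (data i ω)) v P := fun i _ =>
    HasSubgaussianMGF.of_map (hdata i).aemeasurable (by rw [hlaw i]; exact hsub)
  have h := HasSubgaussianMGF.measure_sum_ge_le_of_iIndepFun hind' hs
    (by positivity : (0 : ℝ) ≤ n * θ)
  refine h.trans_eq ?_
  congr 1
  rw [Finset.sum_const, Finset.card_univ, Fintype.card_fin, nsmul_eq_mul]
  rcases Nat.eq_zero_or_pos n with rfl | hn
  · simp
  · rcases eq_or_ne v 0 with rfl | hv
    · simp
    · have : (v : ℝ) ≠ 0 := by exact_mod_cast hv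
      have : (n : ℝ) ≠ 0 := by positivity
      push_cast
      field_simp

/-- A centered statistic bounded by `2` is sub-Gaussian with parameter `4`. -/
theorem hasSubgaussianMGF_of_abs_le_two [IsProbabilityMeasure ν] {Y : β → ℝ} (hY : Measurable Y)
    (h2 : ∀ᵐ z ∂ν, |Y z| ≤ 2) (h0 : ∫ z, Y z ∂ν = 0) : HasSubgaussianMGF Y 4 ν := by
  have h := hasSubgaussianMGF_of_mem_Icc (X := Y) (a := -2) (b := 2) hY.aemeasurable
    (h2.mono fun z hz => abs_le.1 hz)
  simp only [h0, sub_zero] at h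
  convert h using 1
  have : ‖(2 : ℝ) - -2‖₊ = 4 := by
    ext
    norm_num
  rw [this]
  ext
  norm_num

/-- The negative centered square of a statistic bounded by `2` is sub-Gaussian with parameter
`4`. -/
theorem hasSubgaussianMGF_integral_sub_sq [IsProbabilityMeasure ν] {Y : β → ℝ} (hY : Measurable Y)
    (h2 : ∀ᵐ z ∂ν, |Y z| ≤ 2) :
    HasSubgaussianMGF (fun z => ∫ z, Y z ^ 2 ∂ν - Y z ^ 2) 4 ν := by
  have h := (hasSubgaussianMGF_of_mem_Icc (X := fun z => Y z ^ 2) (a := 0) (b := 4)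
    (hY.pow_const 2).aemeasurable (h2.mono fun z hz => by
      have := abs_le.1 hz
      exact ⟨by positivity, by nlinarith⟩)).neg
  convert h using 1
  · ext z
    simp
  · have : ‖(4 : ℝ) - 0‖₊ = 4 := by
      ext
      norm_num
    rw [this]
    ext
    norm_num

end Concentration

/-! ### Overfitting forces correlation of the fluctuation with the noise. -/

section Decomposition

/-- The part of a function that fluctuates around its means over the components of a mixture. -/
noncomputable def mixtureFluctuation {d k : ℕ} (μs : Fin k → Measure (Euc d))
    (r : Fin k → Euc d → ℝ) (F : Euc d → ℝ) (x : Euc d) : ℝ :=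
  ∑ l, r l x * (F x - ∫ x', F x' ∂(μs l))

/-- The sign of a Boolean. -/
def boolSign (b : Bool) : ℝ := if b then 1 else -1

theorem abs_boolSign (b : Bool) : |boolSign b| = 1 := by
  cases b <;> simp [boolSign]

theorem exists_boolSign_mul (x : ℝ) : ∃ b, boolSign b * x = |x| := by
  rcases le_total 0 x with h | h
  · exact ⟨true, by simp [boolSign, abs_of_nonneg h]⟩
  · exact ⟨false, by simp [boolSign, abs_of_nonpos h]⟩

theorem abs_sum_weights_le {ι : Type*} [Fintype ι] {r e : ι → ℝ} (hr0 : ∀ l, 0 ≤ r l)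
    (hr1 : ∑ l, r l = 1) {B : ℝ} (he : ∀ l, |e l| ≤ B) : |∑ l, r l * e l| ≤ B :=
  calc |∑ l, r l * e l| ≤ ∑ l, |r l * e l| := Finset.abs_sum_le_sum_abs _ _
    _ ≤ ∑ l, r l * B := Finset.sum_le_sum fun l _ => by
        rw [abs_mul, abs_of_nonneg (hr0 l)]
        exact mul_le_mul_of_nonneg_left (he l) (hr0 l)
    _ = B := by rw [← Finset.sum_mul, hr1, one_mul]

variable {d k : ℕ} {μ : Measure (Euc d)} {μs : Fin k → Measure (Euc d)} {r : Fin k → Euc d → ℝ}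

theorem measurable_mixtureFluctuation (hrm : ∀ l, Measurable (r l)) {F : Euc d → ℝ}
    (hF : Measurable F) : Measurable (mixtureFluctuation μs r F) :=
  Finset.measurable_fun_sum _ fun l _ => (hrm l).mul (hF.sub_const _)

theorem abs_integral_le_one [∀ l, IsProbabilityMeasure (μs l)] {F : Euc d → ℝ}
    (hF1 : ∀ x, |F x| ≤ 1) (l : Fin k) : |∫ x, F x ∂(μs l)| ≤ 1 := by
  have := norm_integral_le_of_norm_le_const (μ := μs l) (f := F) (C := 1) (ae_of_all _ hF1)
  simpa using this

theorem abs_sub_integral_le_two [∀ l, IsProbabilityMeasure (μs l)] {F : Euc d → ℝ}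
    (hF1 : ∀ x, |F x| ≤ 1) (l : Fin k) (x : Euc d) : |F x - ∫ x', F x' ∂(μs l)| ≤ 2 := by
  have h1 := abs_sub (F x) (∫ x', F x' ∂(μs l))
  have h2 := abs_integral_le_one (μs := μs) hF1 l
  have h3 := hF1 x
  linarith

/-- Square-exponential moment of the fluctuation of a Lipschitz function. -/
theorem integral_exp_sq_mixtureFluctuation_le [IsProbabilityMeasure μ] {c : ℝ} (hc : 0 < c)
    (hd : 0 < d) {a : Fin k → ℝ} (ha : ∀ l, 0 ≤ a l) (ha1 : ∑ l, a l = 1)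
    (hiso : ∀ l, IsIsoperimetric c (μs l)) (hrm : ∀ l, Measurable (r l)) (hr0 : ∀ l x, 0 ≤ r l x)
    (hr1 : ∀ x, ∑ l, r l x = 1)
    (hr : ∀ l (φ : Euc d → ℝ), ∫ x, r l x * φ x ∂μ = a l * ∫ x, φ x ∂(μs l))
    {F : Euc d → ℝ} (hF1 : ∀ x, |F x| ≤ 1) {L : ℝ≥0} (hL : 0 < L) (hF : LipschitzWith L F) :
    ∫ x, Real.exp (mixtureFluctuation μs r F x ^ 2 / (4 * (c * L ^ 2 / d))) ∂μ ≤ 3 := by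
  have hprob : ∀ l, IsProbabilityMeasure (μs l) := fun l => (hiso l).1
  have hFm : Measurable F := hF.continuous.measurable
  have hL' : (0 : ℝ) < L := hL
  have hd' : (0 : ℝ) < d := by exact_mod_cast hd
  have hv : 0 < c * (L : ℝ) ^ 2 / d := by positivity
  refine integral_exp_sq_mixture_le ha ha1 hrm hr0 hr1 hr (fun l => hFm.sub_const _)
    (abs_sub_integral_le_two hF1) hv fun l => ?_
  refine integral_exp_sq_le_of_tail (hFm.sub_const _) (abs_sub_integral_le_two hF1 l) hv
    fun t ht => ?_
  refine ((hiso l).2 F L ⟨1, hF1⟩ hF t ht).trans_eq ?_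
  congr 3
  field_simp

/-- If `F` fits the data below the noise level, then the fluctuation of a function close to `F`
correlates with the noise, unless one of finitely many unlikely events occurs. -/
theorem le_sum_mixtureFluctuation [∀ l, IsProbabilityMeasure (μs l)]
    (hr1 : ∀ x, ∑ l, r l x = 1) {g : Euc d → ℝ}
    {n : ℕ} (hn : 0 < n) {D : Fin n → Euc d × ℝ} {s ε : ℝ}
    (hz : ∀ i, |(D i).2 - g (D i).1| ≤ 2) {F F' : Euc d → ℝ}
    (hclose : ∀ x, |F x - F' x| ≤ ε / 30) (hF' : ∀ x, |F' x| ≤ 1)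
    (htrain : trainingError F D ≤ s - ε)
    (h1 : ∑ i, (s - ((D i).2 - g (D i).1) ^ 2) < n * (ε / 6))
    (h2 : ∑ i, ((D i).2 - g (D i).1) * -g (D i).1 < n * (ε / 6))
    (h3 : ∀ b : Fin k → Bool, ∑ i, ((D i).2 - g (D i).1) * ∑ l, r l (D i).1 * boolSign (b l) <
      n * (ε / 8)) :
    n * (ε / 20) ≤ ∑ i, ((D i).2 - g (D i).1) * mixtureFluctuation μs r F' (D i).1 := by
  have hn' : (0 : ℝ) < n := by exact_mod_cast hn
  set z : Fin n → ℝ := fun i => (D i).2 - g (D i).1 with hzdef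
  have hε : 0 ≤ ε := by
    have := (abs_nonneg _).trans (hclose 0)
    linarith
  have htrain' : ∑ i, (F (D i).1 - (D i).2) ^ 2 ≤ n * (s - ε) := by
    rw [trainingError, one_div, inv_mul_le_iff₀ hn'] at htrain
    exact htrain
  -- The square (g - F)² is dropped from the expansion of (F - y)² around g.
  have hlow : ∑ i, (z i ^ 2 + 2 * (z i * g (D i).1) - 2 * (z i * F (D i).1)) ≤
      ∑ i, (F (D i).1 - (D i).2) ^ 2 :=
    Finset.sum_le_sum fun i _ => by
      have : (F (D i).1 - (D i).2) ^ 2 = (z i ^ 2 + 2 * (z i * g (D i).1) -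
          2 * (z i * F (D i).1)) + (g (D i).1 - F (D i).1) ^ 2 := by
        simp only [hzdef]
        ring
      rw [this]
      exact le_add_of_nonneg_right (sq_nonneg _)
  rw [Finset.sum_sub_distrib, Finset.sum_add_distrib, ← Finset.mul_sum, ← Finset.mul_sum] at hlow
  rw [Finset.sum_sub_distrib, Finset.sum_const, Finset.card_univ, Fintype.card_fin,
    nsmul_eq_mul] at h1
  simp only [mul_neg, Finset.sum_neg_distrib] at h2
  have hdiff : ∑ i, z i * F (D i).1 - ∑ i, z i * F' (D i).1 ≤ n * (ε / 15) := by
    rw [← Finset.sum_sub_distrib]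
    calc ∑ i, (z i * F (D i).1 - z i * F' (D i).1) ≤ ∑ _i : Fin n, ε / 15 :=
          Finset.sum_le_sum fun i _ => by
            rw [← mul_sub]
            refine (le_abs_self _).trans ?_
            rw [abs_mul]
            calc |z i| * |F (D i).1 - F' (D i).1| ≤ 2 * (ε / 30) :=
                  mul_le_mul (hz i) (hclose _) (abs_nonneg _) (by norm_num)
              _ = ε / 15 := by ring
      _ = n * (ε / 15) := by simp
  have hsplit : ∑ i, z i * F' (D i).1 = ∑ i, z i * mixtureFluctuation μs r F' (D i).1 +
      ∑ l, (∫ x, F' x ∂(μs l)) * ∑ i, z i * r l (D i).1 := by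
    have : ∀ i, z i * F' (D i).1 = z i * mixtureFluctuation μs r F' (D i).1 +
        ∑ l, (∫ x, F' x ∂(μs l)) * (z i * r l (D i).1) := fun i => by
      have h : ∑ l, (∫ x, F' x ∂(μs l)) * (z i * r l (D i).1) =
          z i * ∑ l, r l (D i).1 * ∫ x, F' x ∂(μs l) := by
        rw [Finset.mul_sum]
        exact Finset.sum_congr rfl fun l _ => by ring
      rw [h, mixtureFluctuation, ← mul_add, ← Finset.sum_add_distrib]
      have h' : ∑ l, (r l (D i).1 * (F' (D i).1 - ∫ x, F' x ∂(μs l)) +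
          r l (D i).1 * ∫ x, F' x ∂(μs l)) = (∑ l, r l (D i).1) * F' (D i).1 := by
        rw [Finset.sum_mul]
        exact Finset.sum_congr rfl fun l _ => by ring
      rw [h', hr1, one_mul]
    simp only [this, Finset.sum_add_distrib]
    rw [Finset.sum_comm (s := Finset.univ (α := Fin n))]
    simp only [Finset.mul_sum]
  -- The component means of F' lie in [-1, 1], so their contribution is at most that of the worst
  -- sign pattern, which no longer involves F'.
  choose b hb using fun l => exists_boolSign_mul (∑ i, z i * r l (D i).1)
  have hbound : ∑ l, (∫ x, F' x ∂(μs l)) * ∑ i, z i * r l (D i).1 ≤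
      ∑ i, z i * ∑ l, r l (D i).1 * boolSign (b l) := by
    calc ∑ l, (∫ x, F' x ∂(μs l)) * ∑ i, z i * r l (D i).1
        ≤ ∑ l, boolSign (b l) * ∑ i, z i * r l (D i).1 := Finset.sum_le_sum fun l _ => by
          rw [hb l]
          refine (le_abs_self _).trans ?_
          rw [abs_mul]
          exact mul_le_of_le_one_left (abs_nonneg _) (abs_integral_le_one hF' l)
      _ = ∑ i, z i * ∑ l, r l (D i).1 * boolSign (b l) := by
          simp only [Finset.mul_sum]
          rw [Finset.sum_comm]
          exact Finset.sum_congr rfl fun i _ => Finset.sum_congr rfl fun l _ => by ring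
  have h3' := h3 b
  -- The budget: ½(1 - 1/6 - 2/6) = 1/4 for F, minus 1/15 for passing to F' and 1/8 for the means,
  -- leaves 7/120 > 1/20.
  nlinarith

end Decomposition

/-! ### Truncation, and the numerical probability budgets. -/

/-- Truncation to `[-1, 1]`. -/
noncomputable def clip (t : ℝ) : ℝ := max (-1) (min 1 t)

theorem abs_clip_le (t : ℝ) : |clip t| ≤ 1 :=
  abs_le.2 ⟨le_max_left _ _, max_le (by norm_num) (min_le_left _ _)⟩

theorem lipschitzWith_clip : LipschitzWith 1 clip :=
  (LipschitzWith.id.const_min 1).const_max (-1)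

theorem abs_clip_sub_clip_le (s t : ℝ) : |clip s - clip t| ≤ |s - t| := by
  simpa [Real.dist_eq] using lipschitzWith_clip.dist_le_mul s t

/-- Clipping is a contraction that fixes the labels. It supplies the boundedness that isoperimetry
demands, at no cost in training error. -/
theorem trainingError_clip_le {d n : ℕ} (F : Euc d → ℝ) {D : Fin n → Euc d × ℝ}
    (hD : ∀ i, |(D i).2| ≤ 1) : trainingError (fun x => clip (F x)) D ≤ trainingError F D := by
  refine mul_le_mul_of_nonneg_left (Finset.sum_le_sum fun i _ => ?_) (by positivity)
  have hy : clip (D i).2 = (D i).2 := by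
    obtain ⟨h1, h2⟩ := abs_le.1 (hD i)
    rw [clip, min_eq_right h2, max_eq_right h1]
  have := abs_clip_sub_clip_le (F (D i).1) (D i).2
  rw [hy] at this
  exact sq_le_sq.2 this

/-- Two noise events and 2^k sign patterns, at most 4^k in all, each have probability at most
(δ/8)^k. The rate 512 = 8³ is 2 · 4 · 8²: sub-Gaussian parameter 4 at deviation ε/8. -/
theorem two_add_two_pow_mul_exp_le {n k : ℕ} {ε δ : ℝ} (hk : 0 < k) (hδ : 0 < δ) (hδ1 : δ < 1)
    (h : 8 ^ 3 * (k : ℝ) * Real.log (8 * k / δ) ≤ n * ε ^ 2) :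
    (2 + 2 ^ k) * Real.exp (-(n * ε ^ 2 / 512)) ≤ δ / 2 := by
  have hk1 : (1 : ℝ) ≤ k := by exact_mod_cast hk
  have hexp : Real.exp (-(n * ε ^ 2 / 512)) ≤ (δ / 8) ^ k := by
    have h1 : Real.exp (-(n * ε ^ 2 / 512)) ≤ Real.exp (-(k * Real.log (8 * k / δ))) := by
      rw [Real.exp_le_exp]
      linarith
    refine h1.trans ?_
    rw [← Real.log_pow, Real.exp_neg, Real.exp_log (by positivity), ← inv_pow]
    gcongr
    rw [inv_div]
    gcongr
    linarith
  have h24 : (2 + 2 ^ k : ℝ) ≤ 4 ^ k := by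
    have h2 : (2 : ℝ) ≤ 2 ^ k := by
      simpa using pow_le_pow_right₀ (by norm_num : (1 : ℝ) ≤ 2) hk
    have h4 : (4 : ℝ) ^ k = 2 ^ k * 2 ^ k := by rw [← mul_pow]; norm_num
    rw [h4]
    nlinarith
  calc (2 + 2 ^ k) * Real.exp (-(n * ε ^ 2 / 512)) ≤ 4 ^ k * (δ / 8) ^ k := by gcongr
    _ = (δ / 2) ^ k := by rw [← mul_pow]; congr 1; ring
    _ ≤ (δ / 2) ^ 1 := pow_le_pow_of_le_one (by positivity) (by linarith) hk
    _ = δ / 2 := pow_one _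

/-- If the mutual information bound holds at level `τ = 36 D / δ`, where `D` exceeds the effective
number of parameters by `δ / 2 * log (4 / δ)`, then the probability in it is small. -/
theorem le_half_of_information_bound {q p δ : ℝ} (hδ : 0 < δ) (hδ1 : δ < 1) (hp : 0 ≤ p)
    (h : 36 * (p + δ / 2 * Real.log (4 / δ)) / δ / 2 * q ≤
      p * Real.log 2 + Real.exp (-(36 * (p + δ / 2 * Real.log (4 / δ)) / δ / 2))) :
    q ≤ δ / 2 := by
  have hlog : 1 / 2 ≤ Real.log (4 / δ) := by
    have h1 : Real.log 2 ≤ Real.log (4 / δ) :=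
      Real.log_le_log (by norm_num) (by rw [le_div_iff₀ hδ]; linarith)
    linarith [Real.log_two_gt_d9]
  have hl1 : Real.log 2 ≤ 1 := by linarith [Real.log_two_lt_d9]
  set T := p + δ / 2 * Real.log (4 / δ) with hT
  have hTp : p ≤ T := by
    have : 0 ≤ δ / 2 * Real.log (4 / δ) := by positivity
    linarith
  have hTδ : δ / 4 ≤ T := by
    have : δ / 2 * (1 / 2) ≤ δ / 2 * Real.log (4 / δ) := by gcongr
    linarith
  have hT0 : 0 < T := by linarith
  -- The summand δ/2 · log(4/δ) of T serves here: it makes the remainder at most δ/4, itself at most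
  -- T. The right side is then at most 2T, against 18 T q / δ on the left.
  have hexp : Real.exp (-(36 * T / δ / 2)) ≤ δ / 4 := by
    have h1 : Real.log (4 / δ) ≤ 36 * T / δ / 2 := by
      rw [div_div, le_div_iff₀ (by positivity)]
      have : δ / 2 * Real.log (4 / δ) ≤ T := by linarith
      have : 0 ≤ δ * Real.log (4 / δ) := by positivity
      linarith
    calc Real.exp (-(36 * T / δ / 2)) ≤ Real.exp (-Real.log (4 / δ)) := by
          rw [Real.exp_le_exp]
          linarith
      _ = δ / 4 := by rw [Real.exp_neg, Real.exp_log (by positivity), inv_div]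
  have h2 : 36 * T / δ / 2 * q ≤ 2 * T := by
    have : p * Real.log 2 ≤ p := mul_le_of_le_one_right hp hl1
    linarith
  have h3 : 36 * T / δ / 2 * q = 18 * T * (q / δ) := by ring
  rw [h3] at h2
  by_contra! hq
  have h4 : 1 / 2 < q / δ := by rw [lt_div_iff₀ hδ]; linarith
  nlinarith

/-! ### Union bound for the noise events. -/

section Robustness

variable {Ω : Type*} [MeasurableSpace Ω] {P : Measure Ω} {d n k : ℕ}
  {ν : Measure (Euc d × ℝ)} [IsProbabilityMeasure ν] {data : Fin n → Ω → Euc d × ℝ}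

/-- The two deviations of the noise and the deviations of its component sums are unlikely. -/
theorem measureReal_noise_deviation_le (hdata : ∀ i, Measurable (data i)) (hind : iIndepFun data P)
    (hlaw : ∀ i, P.map (data i) = ν) {g : Euc d → ℝ} (hg : Measurable g) (hg1 : ∀ x, |g x| ≤ 1)
    (hz2 : ∀ᵐ z ∂ν, |z.2 - g z.1| ≤ 2)
    (horth : ∀ u : Euc d → ℝ, Measurable u → ∀ B : ℝ, (∀ x, |u x| ≤ B) →
      ∫ z, (z.2 - g z.1) * u z.1 ∂ν = 0)
    {r : Fin k → Euc d → ℝ} (hrm : ∀ l, Measurable (r l)) (hr0 : ∀ l x, 0 ≤ r l x)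
    (hr1 : ∀ x, ∑ l, r l x = 1) {ε δ : ℝ} (hk : 0 < k) (hε : 0 < ε) (hδ : 0 < δ) (hδ1 : δ < 1)
    (h : 8 ^ 3 * (k : ℝ) * Real.log (8 * k / δ) ≤ n * ε ^ 2) :
    P.real ({ω | n * (ε / 6) ≤ ∑ i, (∫ z, (z.2 - g z.1) ^ 2 ∂ν -
          ((data i ω).2 - g (data i ω).1) ^ 2)} ∪
        {ω | n * (ε / 6) ≤ ∑ i, ((data i ω).2 - g (data i ω).1) * -g (data i ω).1} ∪
        ⋃ b : Fin k → Bool, {ω | n * (ε / 8) ≤ ∑ i, ((data i ω).2 - g (data i ω).1) *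
          ∑ l, r l (data i ω).1 * boolSign (b l)}) ≤ δ / 2 := by
  have hZ : Measurable fun z : Euc d × ℝ => z.2 - g z.1 :=
    measurable_snd.sub (hg.comp measurable_fst)
  have hmul : ∀ u : Euc d → ℝ, Measurable u → (∀ x, |u x| ≤ 1) →
      Measurable (fun z : Euc d × ℝ => (z.2 - g z.1) * u z.1) ∧
      HasSubgaussianMGF (fun z : Euc d × ℝ => (z.2 - g z.1) * u z.1) 4 ν := by
    intro u hu hu1
    have hm : Measurable fun z : Euc d × ℝ => (z.2 - g z.1) * u z.1 :=
      hZ.mul (hu.comp measurable_fst)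
    refine ⟨hm, hasSubgaussianMGF_of_abs_le_two hm ?_ (horth u hu 1 hu1)⟩
    filter_upwards [hz2] with z hz
    rw [abs_mul]
    calc _ ≤ 2 * 1 := mul_le_mul hz (hu1 _) (abs_nonneg _) (by norm_num)
      _ = 2 := by norm_num
  have hnε : 0 ≤ n * ε ^ 2 := by positivity
  have h6 : Real.exp (-(n * (ε / 6) ^ 2 / (2 * (4 : ℝ≥0)))) ≤
      Real.exp (-(n * ε ^ 2 / 512)) := by
    rw [Real.exp_le_exp]
    push_cast
    linarith
  have h8 : Real.exp (-(n * (ε / 8) ^ 2 / (2 * (4 : ℝ≥0)))) ≤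
      Real.exp (-(n * ε ^ 2 / 512)) := by
    rw [Real.exp_le_exp]
    push_cast
    linarith
  have hE1 := (measureReal_sum_ge_le hdata hind hlaw ((hZ.pow_const 2).const_sub _)
    (hasSubgaussianMGF_integral_sub_sq hZ hz2) (by positivity : 0 ≤ ε / 6)).trans h6
  obtain ⟨hm2, hs2⟩ := hmul (fun x => -g x) hg.neg fun x => by rw [abs_neg]; exact hg1 x
  have hE2 := (measureReal_sum_ge_le hdata hind hlaw hm2 hs2 (by positivity : 0 ≤ ε / 6)).trans h6
  have hE3 : ∀ b : Fin k → Bool, P.real {ω | n * (ε / 8) ≤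
      ∑ i, ((data i ω).2 - g (data i ω).1) * ∑ l, r l (data i ω).1 * boolSign (b l)} ≤
      Real.exp (-(n * ε ^ 2 / 512)) := fun b => by
    obtain ⟨hm3, hs3⟩ := hmul (fun x => ∑ l, r l x * boolSign (b l))
      (Finset.measurable_fun_sum _ fun l _ => (hrm l).mul_const _)
      fun x => abs_sum_weights_le (fun l => hr0 l x) (hr1 x) fun l => (abs_boolSign _).le
    exact (measureReal_sum_ge_le hdata hind hlaw hm3 hs3 (by positivity : 0 ≤ ε / 8)).trans h8
  refine le_trans ?_ (two_add_two_pow_mul_exp_le hk hδ hδ1 h)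
  refine (measureReal_union_le _ _).trans ?_
  have hU := (measureReal_iUnion_fintype_le (μ := P) fun b : Fin k → Bool =>
    {ω | n * (ε / 8) ≤ ∑ i, ((data i ω).2 - g (data i ω).1) *
      ∑ l, r l (data i ω).1 * boolSign (b l)}).trans (Finset.sum_le_sum fun b _ => hE3 b)
  rw [Finset.sum_const, Finset.card_univ, Fintype.card_fun, Fintype.card_bool, Fintype.card_fin,
    nsmul_eq_mul] at hU
  push_cast at hU
  have hU2 := (measureReal_union_le (μ := P) _ _).trans (add_le_add hE1 hE2)
  calc _ ≤ (Real.exp (-(n * ε ^ 2 / 512)) + Real.exp (-(n * ε ^ 2 / 512))) +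
        2 ^ k * Real.exp (-(n * ε ^ 2 / 512)) := add_le_add hU2 hU
    _ = _ := by ring

end Robustness

end MaskedRobustness

/-! ### The law of robustness. -/

theorem theorem5p3 :
    -- `a₁` is an absolute constant
    ∃ a₁ : ℝ, 0 < a₁ ∧
      ∀ (d p n k : ℕ) (c R J ε δ : ℝ),
        0 < c → 0 ≤ J → 0 < ε → ε < 1 → 0 < δ → δ < 1 →
      -- the masked function class
      ∀ (𝒲 : Set (MaskedRobustness.Euc p))
        (𝒲m : MaskedRobustness.Mask p → Set (MaskedRobustness.Euc p))
        (f : MaskedRobustness.Mask p → MaskedRobustness.Euc p → MaskedRobustness.Euc d → ℝ),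
        Bornology.IsBounded 𝒲 → Metric.diam 𝒲 ≤ R →
        (∀ m, 𝒲m m ⊆ 𝒲) →
        (∀ m, ∀ w ∈ 𝒲m m, ∀ i, m i = false → w i = 0) →
        (∀ m, ∀ w₁ ∈ 𝒲m m, ∀ w₂ ∈ 𝒲m m, ∀ x, |f m w₁ x - f m w₂ x| ≤ J * ‖w₁ - w₂‖) →
      -- the common law `ν` of the pairs `(x, y)`
      ∀ (ν : Measure (MaskedRobustness.Euc d × ℝ)) [IsProbabilityMeasure ν],
        (∀ᵐ z ∂ν, z.2 ∈ Set.Icc (-1 : ℝ) 1) →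
        MaskedRobustness.IsIsoperimetricMixture k c ν.fst →
        0 < MaskedRobustness.noiseLevel ν →
        8 ^ 3 * (k : ℝ) * Real.log (8 * k / δ) ≤ n * ε ^ 2 →
      -- the i.i.d. data and the (possibly randomized) output of the learning algorithm
      ∀ (Ω : Type*) [MeasurableSpace Ω] (P : Measure Ω) [IsProbabilityMeasure P]
        (data : Fin n → Ω → MaskedRobustness.Euc d × ℝ)
        (M : Ω → MaskedRobustness.Mask p) (w : Ω → MaskedRobustness.Euc p),
        (∀ i, Measurable (data i)) → iIndepFun data P → (∀ i, P.map (data i) = ν) →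
        Measurable M → Measurable w → (∀ ω, w ω ∈ 𝒲m (M ω)) →
      ∃ G : Set Ω, MeasurableSet G ∧ 1 - δ ≤ P.real G ∧ ∀ ω ∈ G,
        MaskedRobustness.trainingError (f (M ω) (w ω)) (fun i => data i ω) ≤
            MaskedRobustness.noiseLevel ν - ε →
          ENNReal.ofReal (ε / (96 * a₁ * √(2 * c)) *
              √(n * d * δ /
                (MaskedRobustness.effectiveParams P M (fun ω i => data i ω) R J ε +
                  δ / 2 * Real.log (4 / δ)))) ≤
            MaskedRobustness.lipConst (f (M ω) (w ω)) := by
  open MaskedRobustness in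
  refine ⟨10, by norm_num, ?_⟩
  intro d p n k c R J ε δ hc hJ hε _ hδ hδ1 𝒲 𝒲m f hbdd hdiam hsub hmask hparam ν _ hν hmix _ hnk
    Ω _ P _ data M w hdata hind hlaw hM _ hw
  set peff := effectiveParams P M (fun ω i => data i ω) R J ε with hpeff
  set T := peff + δ / 2 * Real.log (4 / δ) with hT
  set L₀ := ε / (96 * 10 * √(2 * c)) * √(n * d * δ / T) with hL₀
  have hR : 0 ≤ R := Metric.diam_nonneg.trans hdiam
  have hQ1 : 1 ≤ 1 + 60 * R * J / ε := by
    have : 0 ≤ 60 * R * J / ε := by positivity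
    linarith
  have hQlog : 0 ≤ Real.log (1 + 60 * R * J / ε) := Real.log_nonneg hQ1
  have hpeff0 : 0 ≤ peff := by
    rw [hpeff, effectiveParams]
    have : 0 ≤ Real.logb 2 (1 + 60 * R * J / ε) := Real.logb_nonneg (by norm_num) hQ1
    have : 0 ≤ ∫ ω, ((M ω).size : ℝ) ∂P := integral_nonneg fun ω => by positivity
    positivity
  -- A nonpositive threshold makes the claim trivial; this absorbs n = 0 and d = 0.
  by_cases hLpos : 0 < L₀
  swap
  · refine ⟨Set.univ, MeasurableSet.univ, by simp [hδ.le], fun ω _ _ => ?_⟩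
    rw [ENNReal.ofReal_of_nonpos (not_lt.1 hLpos)]
    exact zero_le
  have hsq : 0 < n * d * δ / T := by
    by_contra! h
    rw [hL₀, Real.sqrt_eq_zero_of_nonpos h, mul_zero] at hLpos
    exact hLpos.false
  have hn : 0 < n := by
    rcases Nat.eq_zero_or_pos n with h | h
    · simp [h] at hsq
    · exact h
  have hd : 0 < d := by
    rcases Nat.eq_zero_or_pos d with h | h
    · simp [h] at hsq
    · exact h
  have hn' : (0 : ℝ) < n := by exact_mod_cast hn
  have hd' : (0 : ℝ) < d := by exact_mod_cast hd
  have hT0 : 0 < T := by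
    by_contra! h
    exact hsq.not_ge (div_nonpos_of_nonneg_of_nonpos (by positivity) h)
  obtain ⟨a, μs, ha, ha1, hiso, hμ⟩ := hmix
  have hk : 0 < k := by
    rcases Nat.eq_zero_or_pos k with h | h
    · subst h
      simp at ha1
    · exact h
  have hprob : ∀ l, IsProbabilityMeasure (μs l) := fun l => (hiso l).1
  obtain ⟨r, hrm, hr0, hr1, hr⟩ := exists_mixture_weights ν.fst a ha μs hμ
  obtain ⟨g, hg, hg1, horth, hnoise⟩ := exists_regression ν hν
  have hz2 : ∀ᵐ z ∂ν, |z.2 - g z.1| ≤ 2 := by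
    filter_upwards [hν] with z hz
    have h1 := abs_le.2 hz
    have h2 := abs_sub z.2 (g z.1)
    linarith [hg1 z.1]
  set L : ℝ≥0 := L₀.toNNReal with hLdef
  have hL : 0 < L := Real.toNNReal_pos.2 hLpos
  have hLcoe : (L : ℝ) = L₀ := Real.coe_toNNReal _ hLpos.le
  -- nets of the clipped, `L`-Lipschitz members of the class
  have hnet := fun m => exists_finset_net_mask m
    (S := {w | w ∈ 𝒲m m ∧ LipschitzWith L fun x => clip (f m w x)}) hR hJ
    (by positivity : 0 < ε / 30) (fun w hw => hmask m w hw.1)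
    (fun x hx y hy => (Metric.dist_le_diam_of_mem hbdd (hsub m hx.1) (hsub m hy.1)).trans hdiam)
  choose N hNS hNcard hN using hnet
  have hcardQ : ∀ m, ((N m).card : ℝ) ≤ (1 + 60 * R * J / ε) ^ m.size := fun m => by
    have h := hNcard m
    rwa [show 2 * R * J / (ε / 30) = 60 * R * J / ε by field_simp; ring] at h
  let H : Mask p → Euc p → Euc d → ℝ := fun m w => mixtureFluctuation μs r fun x => clip (f m w x)
  let A : Mask p → Set (Fin n → Euc d × ℝ) := fun m => ⋃ w ∈ N m,
    {D | n * (ε / 20) ≤ ∑ i, ((D i).2 - g (D i).1) * H m w (D i).1}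
  have hHm : ∀ m, ∀ w ∈ N m, Measurable (H m w) := fun m w hw =>
    measurable_mixtureFluctuation hrm (hNS m hw).2.continuous.measurable
  have hAm : ∀ m, MeasurableSet (A m) := fun m => by
    refine Finset.measurableSet_biUnion _ fun w hw => measurableSet_le measurable_const ?_
    have := hHm m w hw
    fun_prop
  have hD : Measurable fun ω i => data i ω := measurable_pi_lambda _ hdata
  have hAprob : ∀ m, (P.map fun ω i => data i ω).real (A m) ≤
      Real.exp (m.size * Real.log (1 + 60 * R * J / ε) - 36 * T / δ) := by
    intro m
    rw [map_measureReal_apply hD (hAm m), sub_eq_add_neg, Real.exp_add, ← Real.log_pow,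
      Real.exp_log (by positivity)]
    have hone : ∀ w ∈ N m, P.real {ω | n * (ε / 20) ≤
        ∑ i, ((data i ω).2 - g (data i ω).1) * H m w (data i ω).1} ≤
        Real.exp (-(36 * T / δ)) := by
      intro w hw
      have hHw := hHm m w hw
      -- 1843200 = 2 · 960², with 960 = 96 a₁ for a₁ = 10. Hoeffding with parameter 64v at deviation
      -- ε/20 has exponent n ε² / (51200 v), and 1843200 / 51200 = 36.
      have hL2 : c * (L : ℝ) ^ 2 / d = n * δ * ε ^ 2 / (1843200 * T) := by
        rw [hLcoe, hL₀, mul_pow, div_pow, mul_pow, Real.sq_sqrt hsq.le,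
          Real.sq_sqrt (by positivity)]
        field_simp
        norm_num
      have hv : 0 < (c * (L : ℝ) ^ 2 / d).toNNReal := Real.toNNReal_pos.2 (by
        have : (0 : ℝ) < L := hL
        positivity)
      have hvcoe : ((c * (L : ℝ) ^ 2 / d).toNNReal : ℝ) = c * (L : ℝ) ^ 2 / d :=
        Real.coe_toNNReal _ (by positivity)
      have hH2 : ∀ x, |H m w x| ≤ 2 := fun x => abs_sum_weights_le (fun l => hr0 l x) (hr1 x)
        fun l => abs_sub_integral_le_two (fun x => abs_clip_le _) l x
      have hexp := integral_exp_sq_mixtureFluctuation_le hc hd ha ha1 hiso hrm hr0 hr1 hr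
        (fun x => abs_clip_le _) hL (hNS m hw).2
      rw [Measure.fst, integral_map measurable_fst.aemeasurable
        ((hHw.pow_const 2).div_const _).exp.aestronglyMeasurable] at hexp
      have hsg := hasSubgaussianMGF_mul (ν := ν) (measurable_snd.sub (hg.comp measurable_fst))
        (hHw.comp measurable_fst) hz2 (fun z => hH2 z.1) hv (horth _ hHw 2 hH2)
        (by rw [hvcoe]; exact hexp)
      refine (measureReal_sum_ge_le hdata hind hlaw ((measurable_snd.sub
        (hg.comp measurable_fst)).mul (hHw.comp measurable_fst)) hsg
        (by positivity : 0 ≤ ε / 20)).trans_eq ?_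
      congr 2
      push_cast
      rw [hvcoe, hL2]
      field_simp
      norm_num
    calc P.real ((fun ω i => data i ω) ⁻¹' A m)
        ≤ ∑ w ∈ N m, P.real {ω | n * (ε / 20) ≤
            ∑ i, ((data i ω).2 - g (data i ω).1) * H m w (data i ω).1} := by
          simp only [A, Set.preimage_iUnion]
          exact measureReal_biUnion_finset_le _ _
      _ ≤ ∑ w ∈ N m, Real.exp (-(36 * T / δ)) := Finset.sum_le_sum hone
      _ = (N m).card * Real.exp (-(36 * T / δ)) := by rw [Finset.sum_const, nsmul_eq_mul]
      _ ≤ _ := by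
          gcongr
          exact hcardQ m
  have hinfo := measureReal_mem_le_mutualInfo P hM hD hAm
    (s := fun m => m.size * Real.log (1 + 60 * R * J / ε)) (fun m => by positivity)
    (by positivity : 0 ≤ 36 * T / δ) hAprob
  have hPA : P.real {ω | (fun i => data i ω) ∈ A (M ω)} ≤ δ / 2 := by
    refine le_half_of_information_bound hδ hδ1 hpeff0 (hinfo.trans_eq ?_)
    congr 1
    have hl2 : Real.log 2 ≠ 0 := (Real.log_pos (by norm_num)).ne'
    -- The entropy of the nets is in nats and the parameter count in bits, hence the common factor
    -- log 2.
    rw [hpeff, effectiveParams, integral_mul_const, Real.logb]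
    field_simp
  have hPE := measureReal_noise_deviation_le hdata hind hlaw hg hg1 hz2 horth hrm hr0 hr1 hk hε hδ
    hδ1 hnk
  rw [← hnoise] at hPE
  let Bad : Set Ω := {ω | trainingError (f (M ω) (w ω)) (fun i => data i ω) ≤ noiseLevel ν - ε ∧
    ¬ ENNReal.ofReal L₀ ≤ lipConst (f (M ω) (w ω))}
  have hdataν : ∀ᵐ ω ∂P, ∀ i, (data i ω).2 ∈ Set.Icc (-1 : ℝ) 1 ∧
      |(data i ω).2 - g (data i ω).1| ≤ 2 := by
    refine ae_all_iff.2 fun i => ?_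
    have h := hν.and hz2
    rw [← hlaw i] at h
    exact ae_of_ae_map (hdata i).aemeasurable h
  have hBad : P.real Bad ≤ δ := by
    refine le_trans ?_ ((measureReal_union_le _ _).trans ((add_le_add hPE hPA).trans_eq
      (add_halves δ)))
    refine ENNReal.toReal_mono (measure_ne_top _ _) (measure_mono_ae
      (ae_le_set.2 (measure_mono_null ?_ (ae_iff.1 hdataν))))
    rintro ω ⟨⟨htrain, hlip⟩, hE⟩ hω
    simp only [Set.mem_union, Set.mem_iUnion, Set.mem_ofPred_eq, not_or, not_exists, not_le] at hE
    obtain ⟨⟨⟨h1, h2⟩, h3⟩, h4⟩ := hE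
    refine h4 ?_
    rw [not_le, lipConst] at hlip
    simp only [iInf_lt_iff] at hlip
    obtain ⟨K, hK, hKL⟩ := hlip
    have hKL' : K ≤ L := (ENNReal.coe_lt_coe.1 hKL).le
    have hclip : LipschitzWith L fun x => clip (f (M ω) (w ω) x) :=
      ((lipschitzWith_clip.comp hK).weaken (by rw [one_mul]; exact hKL'))
    obtain ⟨w', hw', hdist⟩ := hN (M ω) (w ω) ⟨hw ω, hclip⟩
    refine Set.mem_iUnion₂.2 ⟨w', hw', ?_⟩
    refine le_sum_mixtureFluctuation (F := fun x => clip (f (M ω) (w ω) x)) hr1 hn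
      (fun i => (hω i).2) (fun x => ?_) (fun x => abs_clip_le _)
      ((trainingError_clip_le _ fun i => abs_le.2 (hω i).1).trans htrain) h1 h2 h3
    refine (abs_clip_sub_clip_le _ _).trans ((hparam _ _ (hw ω) _ (hNS _ hw').1 x).trans ?_)
    rwa [← dist_eq_norm]
  -- The bad event need not be measurable, as nothing is assumed about how f depends on the weights
  -- beyond the Lipschitz bound; its measurable hull has the same probability.
  refine ⟨(toMeasurable P Bad)ᶜ, (measurableSet_toMeasurable P Bad).compl, ?_,
    fun ω hω htrain => ?_⟩
  · rw [probReal_compl_eq_one_sub (measurableSet_toMeasurable P Bad), measureReal_def,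
      measure_toMeasurable, ← measureReal_def]
    linarith
  · by_contra hlip
    exact hω (subset_toMeasurable P Bad ⟨htrain, hlip⟩)
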